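/- **The scheduling problem (OJS).** An instance consists of a finite set $\mathcal B$ of base stations; a simple graph $G_J=(\mathcal B,\mathcal C)$ (the joint transmission graph) whose edges are backhaul links $e$ with capacities $l_e\in\mathbb N$; a finite set of users $n$, each with a serving base station $\mathrm{BS}(n)$ and possibly a secondary base station $\widehat{\mathrm{BS}}(n)$, which is a neighbour of $\mathrm{BS}(n)$ in $G_J$; a finite set $\mathcal I$ of packets $i$, each with a user $n(i)$ and a bit $\beta(i)\in\{0,1\}$ ($\beta(i)=1$, joint transmission, is possible only if $n(i)$ has a secondary base station); a finite set $\mathcal M$ of transmission schemes; a number $S\in\mathbb N$ of scheduled blocks per base station; sizes $\Gamma(i,0)\in\mathbb N$ (bytes) and $\Gamma(i,r)\in\mathbb N$ (blocks, $r\in\mathcal M$); and utilities $u(i,r)\ge 0$ for $r\in\mathcal R=\{0\}\cup\mathcal M$. Put $h(i)=\{\mathrm{BS}(n(i))\}$ if $\beta(i)=0$ and $h(i)=\{\mathrm{BS}(n(i)),\widehat{\mathrm{BS}}(n(i))\}$ if $\beta(i)=1$. The pair $(i,r)$ means that $i$ is transmitted wirelessly with scheme $r\in\mathcal M$, or forwarded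 over the backhaul link $\{\mathrm{BS}(n(i)),\widehat{\mathrm{BS}}(n(i))\}$ if $r=0$; $(i,0)$ is available only if $\beta(i)=0$ and $n(i)$ has a secondary base station. The problem is to maximize $U(z)=\sum_{i,\,r\in\mathcal R}z_{ir}u(i,r)$ over $z_{ir},x_{irs}\in\{0,1\}$ ($1\le s\le S$) such that 1. $z_{i0}=0$ if $(i,0)$ is not available, and $\sum_{r\in\mathcal R}z_{ir}\le 1$ for every $i$; 2. $\sum_{i:\,b\in h(i)}\sum_{r\in\mathcal M}z_{ir}\Gamma(i,r)\le S$ for every $b\in\mathcal B$, and the sum of $z_{i0}\Gamma(i,0)$ over the packets $i$ whose backhaul link is $e$ is at most $l_e$, for every $e\in\mathcal C$; 3. $\sum_{s}x_{irs}=z_{ir}\Gamma(i,r)$ for every $i$ and $r\in\mathcal M$, and $\sum_{r\in\mathcal M}\sum_{i:\,b\in h(i)}x_{irs}\le 1$ for every $b\in\mathcal B$ and every $s$. **Series-parallel.** A graph or multigraph is series-parallel if it has no subgraph that is a subdivision of $K_4$; such a graph is automatically planar. **Approximation.** For $0<\alpha\le 1$, an algorithm is an $\alpha$-approximation for a maximization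 problem (on a class of instances) if on every instance (of the class) it returns a feasible solution with value at least $\alpha$ times the value of every feasible solution. MMK (multidimensional multiple-choice knapsack) is the problem of choosing at most one item from each of finitely many disjoint finite classes, subject to finitely many capacity constraints with weights and capacities in $\mathbb N$, so as to maximize the sum of the nonnegative profits. **The algorithm.** Let $A$ be an algorithm for MMK, and let $C$ be an edge-colouring algorithm that colours the edges of every finite loopless series-parallel multigraph $G$ with $\chi'(G)$ colours $1,\dots,\chi'(G)$, where $\chi'$ is the chromatic index. * *Knapsack step.* Run $A$ on the MMK instance whose classes are the packets, whose items are the available pairs $(i,r)$, with profits $u(i,r)$, and whose constraints are those in 2. together with, for every $\mathcal B'\subseteq\mathcal B$ with $|\mathcal B'|$ odd and $|\mathcal B'|\ge 3$, one constraint of capacity $S(|\mathcal B'|-1)/2$, in which $(i,r)$ has weight $\Gamma(i,r)$ if $r\in\mathcal M$, $\beta(i)=1$ and $h(i)\subseteq\mathcal B'$, and weight $0$ otherwise. Let $z$ be the choice returned. * *Colouring step.* Let $G_{\mathrm{SB}}(z)$ be the multigraph on $\mathcal B$ and one dummy vertex $\bar b$ for each $b\in\mathcal B$, in which every $(i,r)$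 with $r\in\mathcal M$ and $z_{ir}=1$ contributes $\Gamma(i,r)$ parallel edges, joining the two elements of $h(i)$ if $\beta(i)=1$, and joining $b$ to $\bar b$ if $\beta(i)=0$ and $h(i)=\{b\}$. Run $C$ on it, and put $x_{irs}=1$ if some edge contributed by $(i,r)$ gets the colour $s$, and $x_{irs}=0$ otherwise. **Theorem.** If $A$ is an $\alpha$-approximation for MMK, where $0<\alpha\le 1$, then the algorithm that returns $(z,x)$ is an $\alpha$-approximation for OJS on the instances whose joint transmission graph $G_J$ is (planar and) series-parallel. -/

import Mathlib

/-! ## Series-parallel graphs and edge colourings of multigraphs -/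

namespace SimpleGraph

/-- `H` has a subgraph that is a subdivision of `K₄`: four distinct branch vertices `f 0, …, f 3`
and, for all `i < j`, a path `p i j` of `H` from `f i` to `f j`, such that a vertex that lies on two
different ones of these six paths is an end of both of them. -/
def HasK4Subdivision {V : Type*} (H : SimpleGraph V) : Prop :=
  ∃ (f : Fin 4 → V) (p : ∀ i j : Fin 4, H.Walk (f i) (f j)),
    Function.Injective f ∧
    (∀ i j, i < j → (p i j).IsPath) ∧
    ∀ i j k l, i < j → k < l → (i, j) ≠ (k, l) →
      ∀ v, v ∈ (p i j).support → v ∈ (p k l).support →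
        (v = f i ∨ v = f j) ∧ (v = f k ∨ v = f l)

/-- A graph is series-parallel if it has no subgraph that is a subdivision of `K₄`.
(Such a graph is automatically planar, since every subdivision of `K₅` or of `K₃,₃` contains a
subdivision of `K₄`.) -/
def IsSeriesParallel {V : Type*} (H : SimpleGraph V) : Prop :=
  ¬ H.HasK4Subdivision

end SimpleGraph

namespace Graph

/-- A multigraph is series-parallel if it has no subgraph that is a subdivision of `K₄`. As `K₄` is
simple, such a subgraph uses no loop and no two parallel edges, so this concerns the underlying
simple graph only. -/
def IsSeriesParallel {V E : Type*} (G : Graph V E) : Prop :=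
  G.toSimpleGraph.IsSeriesParallel

/-- `c` is an edge colouring of `G` with the `k` colours `0, …, k - 1`: distinct edges with a common
end have distinct colours. (Values of `c` outside the edge set of `G` are irrelevant.) -/
def IsEdgeColoring {V E : Type*} (G : Graph V E) (k : ℕ) (c : E → ℕ) : Prop :=
  (∀ e ∈ G.edgeSet, c e < k) ∧
  ∀ e ∈ G.edgeSet, ∀ e' ∈ G.edgeSet, e ≠ e' → (∃ v, G.Inc e v ∧ G.Inc e' v) → c e ≠ c e'

/-- The chromatic index: the least number of colours of an edge colouring. -/
noncomputable def chromaticIndex {V E : Type*} (G : Graph V E) : ℕ :=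
  sInf {k | ∃ c : E → ℕ, G.IsEdgeColoring k c}

end Graph

/-- An edge-colouring algorithm maps a multigraph to an assignment of colours to its edges. -/
abbrev EdgeColoringAlgorithm : Type 1 :=
  ∀ V E : Type, Graph V E → E → ℕ

/-- `C` is an (optimal) edge-colouring algorithm for series-parallel multigraphs: on every finite
loopless series-parallel multigraph it returns an edge colouring with as few colours as possible. -/
def EdgeColoringAlgorithm.IsOptimalOnSeriesParallel (C : EdgeColoringAlgorithm) : Prop :=
  ∀ (V E : Type) [Finite V] [Finite E] (G : Graph V E), G.Loopless → G.IsSeriesParallel →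
    G.IsEdgeColoring G.chromaticIndex (C V E G)

/-! ## The multidimensional multiple-choice knapsack problem -/

/-- An instance of the multidimensional multiple-choice knapsack problem (MMK). The items are
partitioned into classes. -/
structure MMKInstance where
  Class : Type
  Item : Type
  Dim : Type
  [finiteClass : Finite Class]
  [fintypeItem : Fintype Item]
  [finiteDim : Finite Dim]
  cls : Item → Class
  profit : Item → ℝ
  profit_nonneg : ∀ j, 0 ≤ profit j
  weight : Item → Dim → ℕ
  capacity : Dim → ℕ

attribute [instance] MMKInstance.finiteClass MMKInstance.fintypeItem MMKInstance.finiteDim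

namespace MMKInstance

open Classical in
/-- A 0-1 vector is feasible if it takes at most one item of each class and respects the capacity
in each dimension. -/
structure Feasible (Q : MMKInstance) (z : Q.Item → ℕ) : Prop where
  binary : ∀ j, z j = 0 ∨ z j = 1
  one_per_class : ∀ c, ∑ j with Q.cls j = c, z j ≤ 1
  capacities : ∀ d, ∑ j, z j * Q.weight j d ≤ Q.capacity d

/-- The total profit. -/
def value (Q : MMKInstance) (z : Q.Item → ℕ) : ℝ :=
  ∑ j, (z j : ℝ) * Q.profit j

end MMKInstance

/-- An algorithm for MMK maps an instance to a vector indexed by its items. -/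
abbrev MMKAlgorithm : Type 1 :=
  (Q : MMKInstance) → Q.Item → ℕ

/-- `A` is an `α`-approximation for MMK: on every instance it returns a feasible solution whose
profit is at least `α` times that of every feasible solution. -/
def MMKAlgorithm.IsApprox (α : ℝ) (A : MMKAlgorithm) : Prop :=
  ∀ Q : MMKInstance, Q.Feasible (A Q) ∧ ∀ z, Q.Feasible z → α * Q.value z ≤ Q.value (A Q)

/-! ## The OFDMA joint scheduling problem -/

/-- An instance of the OFDMA joint scheduling problem (OJS). A configuration of a packet is an
element of `Option MCS`: `some m` is a wireless transmission with modulation and coding scheme `m`,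
and `none` is forwarding over the backhaul. -/
structure OJSInstance where
  /-- the base stations -/
  BS : Type
  User : Type
  /-- the pending packets -/
  Packet : Type
  /-- the modulation and coding schemes -/
  MCS : Type
  [finiteBS : Finite BS]
  [finiteUser : Finite User]
  [fintypePacket : Fintype Packet]
  [fintypeMCS : Fintype MCS]
  /-- the joint transmission graph, whose edges are the backhaul links -/
  GJ : SimpleGraph BS
  /-- the serving base station of a user -/
  serving : User → BS
  /-- the secondary base station of a user, if there is one -/
  secondary : User → Option BS
  secondary_adj : ∀ n b, secondary n = some b → GJ.Adj (serving n) b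
  /-- the receiving user of a packet -/
  user : Packet → User
  /-- whether the packet is in the queue for joint transmission (rather than for single
  transmission) -/
  joint : Packet → Bool
  joint_secondary : ∀ i, joint i = true → (secondary (user i)).isSome
  /-- the number of scheduled blocks in the subframe of each base station -/
  S : ℕ
  /-- the capacity of a backhaul link, in bytes -/
  linkCap : GJ.edgeSet → ℕ
  /-- the size of a packet, in bytes -/
  bytes : Packet → ℕ
  /-- the number of scheduled blocks needed to transmit a packet with a given scheme -/
  blocks : Packet → MCS → ℕ
  utility : Packet → Option MCS → ℝ
  utility_nonneg : ∀ i r, 0 ≤ utility i r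

attribute [instance] OJSInstance.finiteBS OJSInstance.finiteUser OJSInstance.fintypePacket
  OJSInstance.fintypeMCS

namespace OJSInstance

variable (P : OJSInstance)

/-- `P.Uses i b`: the base station `b` takes part in wireless transmissions of the packet `i`. -/
def Uses (i : P.Packet) (b : P.BS) : Prop :=
  b = P.serving (P.user i) ∨ (P.joint i = true ∧ P.secondary (P.user i) = some b)

/-- The packet `i` can be forwarded over the backhaul: it is not yet in the queue for joint
transmission, and its user has a secondary base station. -/
def Forwardable (i : P.Packet) : Prop :=
  P.joint i = false ∧ (P.secondary (P.user i)).isSome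

/-- The backhaul link `e` connects the serving and the secondary base station of the user of `i`. -/
def IsLinkOf (i : P.Packet) (e : P.GJ.edgeSet) : Prop :=
  ∃ b, P.secondary (P.user i) = some b ∧ (e : Sym2 P.BS) = s(P.serving (P.user i), b)

/-- The capacity constraints: one for each base station and one for each backhaul link. -/
abbrev Dim : Type := P.BS ⊕ P.GJ.edgeSet

/-- The capacity in each dimension. -/
def capacity : P.Dim → ℕ
  | .inl _ => P.S
  | .inr e => P.linkCap e

open Classical in
/-- The capacity used by a packet in a given configuration. -/
noncomputable def weight (i : P.Packet) : Option P.MCS → P.Dim → ℕ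
  | some m, .inl b => if P.Uses i b then P.blocks i m else 0
  | some _, .inr _ => 0
  | none, .inl _ => 0
  | none, .inr e => if P.IsLinkOf i e then P.bytes i else 0

/-- The constraints of OJS on the choice `z` of the configurations. -/
structure FeasibleConfig (z : P.Packet → Option P.MCS → ℕ) : Prop where
  binary : ∀ i r, z i r = 0 ∨ z i r = 1
  forwardable : ∀ i, ¬ P.Forwardable i → z i none = 0
  one_config : ∀ i, ∑ r, z i r ≤ 1
  capacities : ∀ d, ∑ i, ∑ r, z i r * P.weight i r d ≤ P.capacity d

open Classical in
/-- The constraints of OJS on the assignment `x` of scheduled blocks to the wireless transmissions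
chosen in `z`. (A joint transmission uses the same blocks at both of its base stations, so `x` has
no index for the base station.) -/
structure FeasibleBlocks (z : P.Packet → Option P.MCS → ℕ)
    (x : P.Packet → P.MCS → Fin P.S → ℕ) : Prop where
  binary : ∀ i m s, x i m s = 0 ∨ x i m s = 1
  sufficient : ∀ i m, ∑ s, x i m s = z i (some m) * P.blocks i m
  used_once : ∀ b s, ∑ m, ∑ i with P.Uses i b, x i m s ≤ 1

/-- A solution of OJS: the configurations `z` and the scheduled blocks `x`. -/
abbrev Solution : Type :=
  (P.Packet → Option P.MCS → ℕ) × (P.Packet → P.MCS → Fin P.S → ℕ)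

/-- Feasibility of a solution of OJS. -/
def Feasible (y : P.Solution) : Prop :=
  P.FeasibleConfig y.1 ∧ P.FeasibleBlocks y.1 y.2

/-- The total utility. -/
def totalUtility (z : P.Packet → Option P.MCS → ℕ) : ℝ :=
  ∑ i, ∑ r, (z i r : ℝ) * P.utility i r

/-! ### The knapsack step -/

/-- The odd sets of at least three base stations. -/
abbrev OddSet : Type := {B' : Finset P.BS // Odd B'.card ∧ 3 ≤ B'.card}

open Classical in
/-- The weight of a packet in a given configuration in the extra dimension of an odd set `B'`: the
number of blocks of a wireless joint transmission with both base stations in `B'`, and zero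
otherwise. -/
noncomputable def oddWeight (i : P.Packet) (B' : P.OddSet) : Option P.MCS → ℕ
    | some m => if P.joint i = true ∧ ∀ b, P.Uses i b → b ∈ B'.1 then P.blocks i m else 0
    | none => 0

/-- The knapsack instance: the classes are the packets, the items are the available pairs of a
packet and a configuration, and the dimensions are those of OJS together with one dimension of
capacity `S(|B'| - 1)/2` for each odd set `B'` of at least three base stations. -/
noncomputable def oddKnapsack : MMKInstance where
  Class := P.Packet
  Item := {j : P.Packet × Option P.MCS // j.2 = none → P.Forwardable j.1}
  Dim := P.Dim ⊕ P.OddSet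
  fintypeItem := Fintype.ofFinite _
  cls := fun j => j.1.1
  profit j := P.utility j.1.1 j.1.2
  profit_nonneg := fun _ => P.utility_nonneg _ _
  weight := fun j d => match d with
    | .inl d => P.weight j.1.1 j.1.2 d
    | .inr B' => P.oddWeight j.1.1 B' j.1.2
  capacity := fun d => match d with
    | .inl d => P.capacity d
    | .inr B' => P.S * (B'.1.card - 1) / 2

open Classical in
/-- The knapsack step: run the knapsack algorithm `A` on the knapsack instance above, and choose the
configurations that it selects. -/
noncomputable def knapsackStep (A : MMKAlgorithm) (P : OJSInstance) :
    P.Packet → Option P.MCS → ℕ :=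
  fun i r =>
    if h : r = none → P.Forwardable i then A P.oddKnapsack ⟨(i, r), h⟩ else 0

/-! ### The colouring step -/

/-- Labels for the edges of the scheduled blocks graph: a packet, a scheme, and the number of one of
the blocks that this transmission needs. -/
abbrev BlockEdge : Type := Σ (i : P.Packet) (m : P.MCS), Fin (P.blocks i m)

/-- The ends of an edge of the scheduled blocks graph: the two base stations if the packet is
jointly transmitted, and the serving base station `b` and its dummy copy `inr b` otherwise. -/
def blockEnds (i : P.Packet) (u v : P.BS ⊕ P.BS) : Prop :=
  if P.joint i = true then
    ∃ b, P.secondary (P.user i) = some b ∧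
      s(u, v) = s(Sum.inl (P.serving (P.user i)), Sum.inl b)
  else s(u, v) = s(Sum.inl (P.serving (P.user i)), Sum.inr (P.serving (P.user i)))

/-- The scheduled blocks graph of a choice `z` of configurations. Its vertices are the base stations
and one dummy vertex for each of them. Each wireless transmission chosen in `z` contributes one edge
for each block that it needs. -/
def blocksGraph (z : P.Packet → Option P.MCS → ℕ) : Graph (P.BS ⊕ P.BS) P.BlockEdge where
  vertexSet := Set.univ
  IsLink e u v := z e.1 (some e.2.1) = 1 ∧ P.blockEnds e.1 u v
  isLink_symm := by
    intro e _
    refine ⟨fun u v h => ⟨h.1, ?_⟩⟩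
    have h2 := h.2
    unfold blockEnds at h2 ⊢
    rwa [Sym2.eq_swap]
  eq_or_eq_of_isLink_of_isLink := by
    rintro e x y v w ⟨-, h⟩ ⟨-, h'⟩
    have key : s(x, y) = s(v, w) := by
      unfold blockEnds at h h'
      split_ifs at h h'
      · obtain ⟨b, hb, hs⟩ := h
        obtain ⟨b', hb', hs'⟩ := h'
        obtain rfl : b = b' := by simpa [hb] using hb'
        rw [hs, hs']
      · rw [h, h']
    rcases Sym2.eq_iff.1 key with h | h
    · exact Or.inl h.1
    · exact Or.inr h.1
  left_mem_of_isLink := fun _ _ _ _ => Set.mem_univ _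

open Classical in
/-- The colouring step: run the edge-colouring algorithm `C` on the scheduled blocks graph, and let
a chosen transmission use the scheduled block `s` if one of its edges has the colour `s`. -/
noncomputable def coloringStep (C : EdgeColoringAlgorithm) (P : OJSInstance)
    (z : P.Packet → Option P.MCS → ℕ) : P.Packet → P.MCS → Fin P.S → ℕ :=
  fun i m s =>
    if z i (some m) = 1 ∧ ∃ k : Fin (P.blocks i m), C _ _ (P.blocksGraph z) ⟨i, m, k⟩ = s then 1 else 0

end OJSInstance

/-- An algorithm for OJS maps an instance to a solution. -/
abbrev OJSAlgorithm : Type 1 :=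
  (P : OJSInstance) → P.Solution

/-- `A` is an `α`-approximation for OJS on the instances in the class `N`: on each of them it
returns a feasible solution whose utility is at least `α` times that of every feasible solution. -/
def OJSAlgorithm.IsApproxOn (N : OJSInstance → Prop) (α : ℝ) (A : OJSAlgorithm) : Prop :=
  ∀ P : OJSInstance, N P → P.Feasible (A P) ∧
    ∀ y : P.Solution, P.Feasible y → α * P.totalUtility y.1 ≤ P.totalUtility (A P).1

/-- The decomposition framework: first choose the configurations with an algorithm `K`, then assign
the scheduled blocks to them with an algorithm `L`. -/
def decomposition (K : (P : OJSInstance) → P.Packet → Option P.MCS → ℕ)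
    (L : (P : OJSInstance) → (P.Packet → Option P.MCS → ℕ) → P.Packet → P.MCS → Fin P.S → ℕ) :
    OJSAlgorithm :=
  fun P => (K P, L P (K P))

/-! When `G_J` is series-parallel, the knapsack instance describes exactly the choices `z` that
extend to a feasible solution.

The odd set constraints are necessary. In a feasible solution, the joint transmissions inside an odd
set `B'` that use a given block form a matching, so there are at most `(|B'| - 1)/2` of them;
summing over the `S` blocks gives the constraint (`odd_bound_of_feasibleBlocks`). Hence every
feasible solution is also feasible for the knapsack, and `α` times its utility bounds the utility of
the returned `z` from below.

They are also sufficient, by Seymour's theorem for series-parallel multigraphs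
(`WeightedGraph.exists_coloring`): the degree bound and the odd set bound for `k` imply a colouring
with `k` colours. It is applied with `k = S` to the joint transmissions; a pendant edge at a dummy
vertex meets other edges only at `b` or is parallel to them, so the colours left over at `b` serve
for it. Thus the chromatic index is at most `S` (`exists_isEdgeColoring`). Pendant edges create no
`K₄` subdivision, so `C` is optimal on this graph and its colours are block numbers.

Seymour's theorem is proved by induction over 2-trees. A graph without a `K₄` subdivision has a
vertex with at most two neighbours, because minimum degree three forces such a subdivision
(`hasK4Subdivision_of_degrees`); eliminating it shows that the graph lies in a 2-tree
(`exists_tree`). A 2-tree with more than one non-root vertex contains twins or a fan, in either case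
a small part attached at only two vertices `s` and `t` (`exists_redex`). Such a part is replaced by
a gadget that keeps both bounds. Let `U` and `U'` be the colour sets reserved at `s` and `t` for the
deleted edges. The removed part can be coloured if `|U ∩ U'|` is neither too small nor too large. In
the gadget, `L` edges `st` force `L` common colours, and `p` and `q` edges from `y` to `s` and `t`
force `|U ∪ U'| ≥ L + p + q`, which limits the common ones. Finding `L`, `p`, `q` that achieve this
without violating the bounds is the arithmetic core (`exists_gadget_parameters`, `exists_split_two`,
`exists_split_three`). -/

namespace WeightedGraph

/-! ### Multiplicity functions, degree and odd set bounds, and the gadget. -/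

open Finset

variable {V : Type*}

/-- Twice the number of edges with both ends in `X` (when there are no loops). -/
def degSumOn (w : Sym2 V → ℕ) (X : Finset V) : ℕ := ∑ u ∈ X, ∑ v ∈ X, w s(u, v)

/-- The degree bound and the odd set bound for edge colourings with `k` colours. -/
structure IsBounded [Fintype V] (k : ℕ) (w : Sym2 V → ℕ) : Prop where
  diag : ∀ v, w s(v, v) = 0
  deg : ∀ v, ∑ u, w s(v, u) ≤ k
  odd : ∀ X : Finset V, Odd X.card → degSumOn w X + k ≤ k * X.card

/-- An edge colouring of the multigraph with multiplicities `w`: the `w e` parallel edges with ends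
`e` receive the colours in `φ e`. -/
structure IsColoring (k : ℕ) (w : Sym2 V → ℕ) (φ : Sym2 V → Finset ℕ) : Prop where
  sub : ∀ e, φ e ⊆ range k
  card : ∀ e, (φ e).card = w e
  disj : ∀ e e' v, v ∈ e → v ∈ e' → e ≠ e' → Disjoint (φ e) (φ e')

theorem degSumOn_insert [DecidableEq V] (w : Sym2 V → ℕ) {v : V} {Y : Finset V} (hv : v ∉ Y) :
    degSumOn w (insert v Y) = degSumOn w Y + 2 * ∑ u ∈ Y, w s(v, u) + w s(v, v) := by
  unfold degSumOn
  rw [sum_insert hv, sum_insert hv]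
  have : ∑ u ∈ Y, ∑ x ∈ insert v Y, w s(u, x) =
      ∑ u ∈ Y, w s(v, u) + ∑ u ∈ Y, ∑ x ∈ Y, w s(u, x) := by
    rw [← sum_add_distrib]
    refine sum_congr rfl fun u _ => ?_
    rw [sum_insert hv, Sym2.eq_swap]
  rw [this]
  ring

theorem degSumOn_add_cut_le [DecidableEq V] [Fintype V] {k : ℕ} {w : Sym2 V → ℕ}
    (hdeg : ∀ v, ∑ u, w s(v, u) ≤ k)
    {X J : Finset V} (h : Disjoint X J) :
    degSumOn w X + ∑ j ∈ J, ∑ u ∈ X, w s(j, u) ≤ k * X.card := by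
  rw [sum_comm, degSumOn, ← sum_add_distrib, mul_comm, ← smul_eq_mul]
  refine sum_le_card_nsmul _ _ _ fun u _ => le_trans ?_ (hdeg u)
  have : ∑ j ∈ J, w s(j, u) = ∑ j ∈ J, w s(u, j) := sum_congr rfl fun _ _ => by rw [Sym2.eq_swap]
  rw [this, ← sum_union h]
  exact sum_le_sum_of_subset (subset_univ _)

theorem degSumOn_le [DecidableEq V] [Fintype V] {k : ℕ} {w : Sym2 V → ℕ}
    (hdeg : ∀ v, ∑ u, w s(v, u) ≤ k)
    (X : Finset V) : degSumOn w X ≤ k * X.card := by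
  simpa using degSumOn_add_cut_le hdeg (disjoint_empty_right X)

/-- Only the other `|X| - 1` vertices contribute, each at most `k`; no parity is needed. -/
theorem degSumOn_le_of_isolated [DecidableEq V] [Fintype V] {k : ℕ} {w : Sym2 V → ℕ}
    (hdeg : ∀ v, ∑ u, w s(v, u) ≤ k)
    {X : Finset V} {i : V} (hi : i ∈ X) (h0 : ∀ u, w s(i, u) = 0) :
    degSumOn w X + k ≤ k * X.card := by
  have h := degSumOn_insert w (notMem_erase i X)
  rw [insert_erase hi, h0, sum_eq_zero fun u _ => h0 u] at h
  have := degSumOn_le hdeg (X.erase i)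
  rw [← card_erase_add_one hi, mul_add]
  omega

theorem sum_eq_of_two_neighbours [DecidableEq V] (w : Sym2 V → ℕ) {i s t : V} (hst : s ≠ t)
    {Y : Finset V}
    (h : ∀ x ∈ Y, x ≠ s → x ≠ t → w s(i, x) = 0) :
    ∑ u ∈ Y, w s(i, u) =
      (if s ∈ Y then w s(i, s) else 0) + (if t ∈ Y then w s(i, t) else 0) := by
  have h1 : ∀ u ∈ Y, w s(i, u) =
      (if u = s then w s(i, s) else 0) + (if u = t then w s(i, t) else 0) := by
    intro u hu
    by_cases h1 : u = s
    · subst h1; simp [hst]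
    · by_cases h2 : u = t
      · subst h2; simp [h1]
      · simp [h1, h2, h u hu h1 h2]
  rw [sum_congr rfl h1, sum_add_distrib, sum_ite_eq', sum_ite_eq']

theorem sum_bundle [DecidableEq V] [Fintype V] {a b : V} (hab : a ≠ b) (n : ℕ) (v : V) :
    ∑ u, (if s(v, u) = s(a, b) then n else 0) = if v = a ∨ v = b then n else 0 := by
  by_cases h1 : v = a
  · subst h1; simp [hab]
  · by_cases h2 : v = b
    · subst h2
      have : ∀ u, s(v, u) = s(a, v) ↔ u = a := fun u => by
        rw [Sym2.eq_swap]; exact Sym2.congr_left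
      simp [this]
    · simp [h1, h2]

theorem degSumOn_bundle [DecidableEq V] {a b : V} (hab : a ≠ b) (n : ℕ) (X : Finset V) :
    degSumOn (fun e => if e = s(a, b) then n else 0) X = if a ∈ X ∧ b ∈ X then 2 * n else 0 := by
  have h : ∀ u v, (if s(u, v) = s(a, b) then n else 0) =
      (if u = a then if v = b then n else 0 else 0) +
      (if u = b then if v = a then n else 0 else 0) := by
    intro u v
    have := @Sym2.eq_iff _ u v a b
    split_ifs <;> simp_all
  have h' : ∀ c d : V, (∑ u ∈ X, ∑ v ∈ X, if u = c then if v = d then n else 0 else 0) =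
      if c ∈ X then if d ∈ X then n else 0 else 0 := by
    intro c d
    rw [← sum_ite_eq' X c fun _ => if d ∈ X then n else 0]
    refine sum_congr rfl fun u _ => ?_
    split_ifs <;> simp_all
  simp only [degSumOn, h, sum_add_distrib, h']
  by_cases a ∈ X <;> by_cases b ∈ X <;> simp_all [two_mul]

theorem degSumOn_add (w₁ w₂ : Sym2 V → ℕ) (X : Finset V) :
    degSumOn (fun e => w₁ e + w₂ e) X = degSumOn w₁ X + degSumOn w₂ X := by
  simp [degSumOn, sum_add_distrib]

/-- Delete all edges with an end in `I`. -/
def del [DecidableEq V] (w : Sym2 V → ℕ) (I : Finset V)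
    (e : Sym2 V) : ℕ := if ∃ i ∈ I, i ∈ e then 0 else w e

theorem del_eq_zero [DecidableEq V] (w : Sym2 V → ℕ) {I : Finset V} {i : V} (hi : i ∈ I) (u : V) :
    del w I s(i, u) = 0 := if_pos ⟨i, hi, by simp⟩

theorem del_eq [DecidableEq V] (w : Sym2 V → ℕ) {I : Finset V} {u v : V} (hu : u ∉ I) (hv : v ∉ I) :
    del w I s(u, v) = w s(u, v) := by
  refine if_neg ?_
  rintro ⟨i, hi, hi'⟩
  rcases Sym2.mem_iff.1 hi' with rfl | rfl <;> contradiction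

theorem degSumOn_del [DecidableEq V] (w : Sym2 V → ℕ) (I X : Finset V) : degSumOn
    (del w I) X = degSumOn w (X \ I) := by
  have h0 : ∀ u ∈ I, ∀ v, del w I s(v, u) = 0 := fun u hu v => by
    rw [Sym2.eq_swap]; exact del_eq_zero w hu v
  unfold degSumOn
  symm
  rw [← sum_subset (sdiff_subset : X \ I ⊆ X)]
  · refine sum_congr rfl fun u hu => ?_
    rw [← sum_subset (sdiff_subset : X \ I ⊆ X)]
    · exact sum_congr rfl fun v hv => (del_eq w (mem_sdiff.1 hu).2 (mem_sdiff.1 hv).2).symm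
    · intro v hv hv'
      exact h0 v (by simp_all) u
  · intro u hu hu'
    exact sum_eq_zero fun v _ => del_eq_zero w (by simp_all) v

theorem sum_del [DecidableEq V] [Fintype V] (w : Sym2 V → ℕ) {I : Finset V} {v : V} (hv : v ∉ I) :
    ∑ u, del w I s(v, u) + ∑ i ∈ I, w s(v, i) = ∑ u, w s(v, u) := by
  rw [← sum_compl_add_sum I (fun u => w s(v, u)), ← sum_compl_add_sum I (fun u => del w I s(v, u))]
  rw [sum_eq_zero (s := I) fun i hi => by rw [Sym2.eq_swap]; exact del_eq_zero w hi v, add_zero]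
  congr 1
  exact sum_congr rfl fun u hu => del_eq w hv (by simpa using hu)

/-- Replace the part of the graph on the vertices in `I`, attached at `s` and `t`, by `L` edges
between `s` and `t`, and `p` and `q` edges from `y` to `s` and `t`. -/
def gadget [DecidableEq V] (w : Sym2 V → ℕ) (I : Finset V) (y s t : V) (L p q : ℕ)
    (e : Sym2 V) : ℕ :=
  del w I e + ((if e = s(s, t) then L else 0) +
    ((if e = s(y, s) then p else 0) + (if e = s(y, t) then q else 0)))

/-- The degrees at `s` and `t` do not grow because at least as many edges to `I` were deleted as
were added. For an odd set inside the complement of `I`, only `L` matters (`h1`); an odd set through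
`y` is `y` together with an even set `Y`, and the cases are which of `s`, `t` lie in `Y` (`h2`,
`h3`, `h4`). -/
theorem IsBounded.gadget [DecidableEq V] [Fintype V] {k : ℕ} {w : Sym2 V → ℕ}
    (hw : IsBounded k w) {I : Finset V}
    {y s t : V} {L p q : ℕ} (hy : y ∈ I) (hs : s ∉ I) (ht : t ∉ I) (hst : s ≠ t)
    (hLp : L + p ≤ ∑ i ∈ I, w s(s, i)) (hLq : L + q ≤ ∑ i ∈ I, w s(t, i)) (hpq : p + q ≤ k)
    (h1 : ∀ Y : Finset V, Disjoint Y I → Odd Y.card → s ∈ Y → t ∈ Y →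
      degSumOn w Y + 2 * L + k ≤ k * Y.card)
    (h2 : ∀ Y : Finset V, Disjoint Y I → Even Y.card → s ∈ Y → t ∈ Y →
      degSumOn w Y + 2 * (L + p + q) ≤ k * Y.card)
    (h3 : ∀ Y : Finset V, Disjoint Y I → Even Y.card → s ∈ Y → t ∉ Y →
      degSumOn w Y + 2 * p ≤ k * Y.card)
    (h4 : ∀ Y : Finset V, Disjoint Y I → Even Y.card → s ∉ Y → t ∈ Y →
      degSumOn w Y + 2 * q ≤ k * Y.card) :
    IsBounded k (gadget w I y s t L p q) := by
  have hys : y ≠ s := fun h => hs (h ▸ hy)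
  have hyt : y ≠ t := fun h => ht (h ▸ hy)
  have hdeg : ∀ v, ∑ u, WeightedGraph.gadget w I y s t L p q s(v, u) =
      ∑ u, del w I s(v, u) + ((if v = s ∨ v = t then L else 0) +
        ((if v = y ∨ v = s then p else 0) + (if v = y ∨ v = t then q else 0))) := by
    intro v
    simp only [WeightedGraph.gadget, sum_add_distrib, sum_bundle hst, sum_bundle hys,
      sum_bundle hyt]
  have hdeg' : ∀ v, ∑ u, WeightedGraph.gadget w I y s t L p q s(v, u) ≤ k := by
    intro v
    rw [hdeg]
    by_cases hv : v ∈ I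
    · rw [sum_eq_zero fun u _ => del_eq_zero w hv u]
      have : v ≠ s := fun h => hs (h ▸ hv)
      have : v ≠ t := fun h => ht (h ▸ hv)
      by_cases v = y <;> simp_all
    · have hvy : v ≠ y := fun h => hv (h ▸ hy)
      have h5 := sum_del w hv
      have h6 := hw.deg v
      by_cases hvs : v = s
      · subst hvs
        simp only [hst, hvy, or_true, if_true, or_false, if_false]
        omega
      · by_cases hvt : v = t
        · subst hvt
          simp only [hvs, hvy, or_true, if_true, or_false, if_false]
          omega
        · simp only [hvs, hvt, hvy, or_false, if_false]
          omega
  refine ⟨fun v => ?_, hdeg', fun X hX => ?_⟩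
  · have hd : ∀ {a b : V}, a ≠ b → s(v, v) ≠ s(a, b) := by
      intro a b hab h
      rcases Sym2.eq_iff.1 h with ⟨rfl, rfl⟩ | ⟨rfl, rfl⟩ <;> exact hab rfl
    simp [WeightedGraph.gadget, hd hst, hd hys, hd hyt, del, hw.diag]
  -- All vertices of `I` except `y` are isolated in the new graph.
  · by_cases hi : ∃ i ∈ X, i ∈ I ∧ i ≠ y
    · obtain ⟨i, hiX, hiI, hiy⟩ := hi
      refine degSumOn_le_of_isolated hdeg' hiX fun u => ?_
      have his : i ≠ s := fun h => hs (h ▸ hiI)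
      have hit : i ≠ t := fun h => ht (h ▸ hiI)
      simp [WeightedGraph.gadget, del_eq_zero w hiI, his, hit, hiy]
    · push Not at hi
      have hin : degSumOn (WeightedGraph.gadget w I y s t L p q) X = degSumOn w (X \ I) +
          ((if s ∈ X ∧ t ∈ X then 2 * L else 0) + ((if y ∈ X ∧ s ∈ X then 2 * p else 0) +
            (if y ∈ X ∧ t ∈ X then 2 * q else 0))) := by
        rw [← degSumOn_del, ← degSumOn_bundle hst, ← degSumOn_bundle hys, ← degSumOn_bundle hyt,
          ← degSumOn_add, ← degSumOn_add, ← degSumOn_add]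
        rfl
      rw [hin]
      by_cases hyX : y ∈ X
      · have hXI : X \ I = X.erase y := by
          ext x
          simp only [mem_sdiff, mem_erase]
          constructor
          · rintro ⟨hx, hx'⟩
            exact ⟨fun h => hx' (h ▸ hy), hx⟩
          · rintro ⟨hx, hx'⟩
            exact ⟨hx', fun h => hx (hi x hx' h)⟩
        have hdis : Disjoint (X.erase y) I := by rw [← hXI]; exact sdiff_disjoint
        have hc := card_erase_add_one hyX
        have hev : Even (X.erase y).card := by
          rw [← hc] at hX
          simpa [Nat.odd_add, Nat.odd_add_one] using hX
        have h2 := h2 _ hdis hev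
        have h3 := h3 _ hdis hev
        have h4 := h4 _ hdis hev
        have h5 := degSumOn_le hw.deg (X.erase y)
        rw [hXI, ← hc, mul_add]
        simp only [mem_erase, hys.symm, hyt.symm, ne_eq, not_false_eq_true, true_and] at h2 h3 h4
        simp only [hyX, true_and]
        by_cases hsX : s ∈ X <;> by_cases htX : t ∈ X <;>
          simp only [hsX, htX, if_true, if_false, and_self, and_true, and_false,
            not_true, not_false_eq_true, forall_const] at h2 h3 h4 ⊢ <;> omega
      · have hXI : X \ I = X := by
          rw [_root_.sdiff_eq_self_iff_disjoint, disjoint_left]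
          exact fun x hx' hx => hyX (hi x hx hx' ▸ hx)
        have h1 := h1 X (_root_.sdiff_eq_self_iff_disjoint.1 hXI).symm hX
        have h5 := hw.odd X hX
        rw [hXI]
        simp only [hyX, false_and, if_false]
        by_cases hsX : s ∈ X <;> by_cases htX : t ∈ X <;>
          simp only [hsX, htX, if_true, if_false, and_self, and_true, and_false,
            forall_const] at h1 ⊢ <;> omega

theorem IsColoring.card_free [Fintype V] {k : ℕ} {w : Sym2 V → ℕ} {φ : Sym2 V → Finset ℕ}
    (h : IsColoring k w φ) (v : V) :
    k ≤ (range k \ univ.biUnion fun x => φ s(v, x)).card + ∑ x, w s(v, x) := by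
  have h1 : (univ.biUnion fun x => φ s(v, x)).card ≤ ∑ x, w s(v, x) :=
    card_biUnion_le.trans (sum_le_sum fun x _ => (h.card _).le)
  have h2 := le_card_sdiff (univ.biUnion fun x => φ s(v, x)) (range k)
  rw [card_range] at h2
  omega

/-- At least `k` minus the degree of `v` colours are missing at `v`, so a set `D` of missing colours
can be enlarged up to that size. -/
theorem exists_free_superset [DecidableEq V] [Fintype V] {k : ℕ} {w : Sym2 V → ℕ}
    {φ : Sym2 V → Finset ℕ}
    (h : IsColoring k w φ) {v : V} {D : Finset ℕ} (hD : D ⊆ range k)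
    (hDd : ∀ x, Disjoint D (φ s(v, x))) {n : ℕ} (hn : D.card ≤ n) (hk : ∑ x, w s(v, x) + n ≤ k) :
    ∃ U, D ⊆ U ∧ U ⊆ range k ∧ U.card = n ∧ ∀ x, Disjoint U (φ s(v, x)) := by
  have h1 := h.card_free v
  obtain ⟨U, hU1, hU2, hU3⟩ := exists_subsuperset_card_eq
    (s := D) (t := range k \ univ.biUnion fun x => φ s(v, x)) (n := n)
    (by
      intro c hc
      simp only [mem_sdiff, mem_biUnion, mem_univ, true_and, not_exists]
      exact ⟨hD hc, fun x hx => disjoint_left.1 (hDd x) hc hx⟩) hn (by omega)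
  refine ⟨U, hU1, hU2.trans sdiff_subset, hU3, fun x => disjoint_left.2 fun c hc hc' => ?_⟩
  have := hU2 hc
  simp only [mem_sdiff, mem_biUnion, mem_univ, true_and, not_exists] at this
  exact this.2 x hc'

/-- What a colouring of the gadget says about the rest of the graph: `L` colours of the bundle `st`
are freed and put into both `U` and `U'`, the colours of `ys` go into `U` and those of `yt` into
`U'`. These three groups are pairwise disjoint. The degree bound of `w` leaves enough free colours
to fill `U` and `U'` up to the number of deleted edges. -/
theorem IsColoring.exists_of_gadget [DecidableEq V] [Fintype V] {k : ℕ} {w : Sym2 V → ℕ}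
    (hdeg : ∀ v, ∑ u, w s(v, u) ≤ k) {I : Finset V} {y s t : V} {L p q : ℕ} (hy : y ∈ I)
    (hs : s ∉ I) (ht : t ∉ I) (hst : s ≠ t)
    (hLp : L + p ≤ ∑ i ∈ I, w s(s, i)) (hLq : L + q ≤ ∑ i ∈ I, w s(t, i))
    {φ : Sym2 V → Finset ℕ} (h : IsColoring k (gadget w I y s t L p q) φ) :
    ∃ (ψ : Sym2 V → Finset ℕ) (U U' : Finset ℕ), IsColoring k (del w I) ψ ∧
      U ⊆ range k ∧ U' ⊆ range k ∧ U.card = ∑ i ∈ I, w s(s, i) ∧ U'.card = ∑ i ∈ I, w s(t, i) ∧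
      (∀ x, Disjoint U (ψ s(s, x))) ∧ (∀ x, Disjoint U' (ψ s(t, x))) ∧
      L ≤ (U ∩ U').card ∧ L + p + q ≤ (U ∪ U').card := by
  have hys : y ≠ s := fun h => hs (h ▸ hy)
  have hyt : y ≠ t := fun h => ht (h ▸ hy)
  have c1 := h.card s(s, t)
  have c2 := h.card s(y, s)
  have c3 := h.card s(y, t)
  have e1 : s(s, t) ≠ s(y, s) := by simp [hys.symm, hyt.symm, hst.symm]
  have e2 : s(s, t) ≠ s(y, t) := by simp [hys.symm, hst]
  have e3 : s(y, s) ≠ s(y, t) := fun h => hst (Sym2.congr_right.1 h)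
  simp only [gadget, e1, e2, e3, e1.symm, e2.symm, e3.symm, if_true, if_false,
    del_eq_zero w hy] at c1 c2 c3
  -- The pair `st` may already carry edges of `w`; only `L` of its colours are taken away.
  obtain ⟨D, hD, hDc⟩ := exists_subset_card_eq (s := φ s(s, t)) (n := L) (by omega)
  set ψ : Sym2 V → Finset ℕ := fun e =>
    if e = s(s, t) then φ e \ D else if ∃ i ∈ I, i ∈ e then ∅ else φ e with hψ
  have hsub : ∀ e, ψ e ⊆ φ e := by
    intro e
    simp only [hψ]
    split_ifs <;> simp
  have hcol : IsColoring k (del w I) ψ := by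
    refine ⟨fun e => (hsub e).trans (h.sub e), fun e => ?_, fun e e' v hv hv' hne =>
      (h.disj e e' v hv hv' hne).mono (hsub e) (hsub e')⟩
    simp only [hψ]
    split_ifs with h1 h2
    · rw [h1, card_sdiff_of_subset hD, hDc]; omega
    · simp [del, h2]
    · have h3 : e ≠ s(y, s) := by rintro rfl; exact h2 ⟨y, hy, by simp⟩
      have h4 : e ≠ s(y, t) := by rintro rfl; exact h2 ⟨y, hy, by simp⟩
      rw [h.card]
      simp [gadget, h1, h3, h4]
  have hψy : ∀ x, ψ s(y, x) = ∅ := fun x => by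
    rw [← card_eq_zero, hcol.card, del_eq_zero w hy]
  have hψst : Disjoint D (ψ s(s, t)) := by simp [hψ, disjoint_sdiff]
  have hφ : ∀ v x, v ≠ y → Disjoint (φ s(y, v)) (ψ s(v, x)) := by
    intro v x hv
    by_cases hx : x = y
    · subst hx; rw [Sym2.eq_swap (b := x), hψy]; simp
    · exact (h.disj _ _ v (by simp) (by simp) (by simp [hv.symm, Ne.symm hx])).mono_right (hsub _)
  have hDs : ∀ x, Disjoint D (ψ s(s, x)) := by
    intro x
    by_cases hx : x = t
    · rw [hx]; exact hψst
    · exact (h.disj s(s, t) s(s, x) s (by simp) (by simp) 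
        fun h => hx (Sym2.congr_right.1 h).symm).mono hD
        (hsub _)
  have hDt : ∀ x, Disjoint D (ψ s(t, x)) := by
    intro x
    by_cases hx : x = s
    · rw [hx, Sym2.eq_swap]; exact hψst
    · exact (h.disj s(s, t) s(t, x) t (by simp) (by simp) 
        fun h => hx (Sym2.congr_right.1 (Sym2.eq_swap.trans h)).symm).mono hD
        (hsub _)
  have d1 := (h.disj _ _ s (by simp) (by simp) e1).mono_left hD
  have d2 := (h.disj _ _ t (by simp) (by simp) e2).mono_left hD
  have d3 := h.disj _ _ y (by simp) (by simp) e3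
  have hDk := hD.trans (h.sub _)
  obtain ⟨U, u1, u2, u3, u4⟩ := exists_free_superset hcol (v := s) (D := D ∪ φ s(y, s))
    (n := ∑ i ∈ I, w s(s, i)) (union_subset hDk (h.sub _))
    (fun x => disjoint_union_left.2 ⟨hDs x, hφ s x hys.symm⟩)
    (by rw [card_union_of_disjoint d1]; omega) (by rw [sum_del w hs]; exact hdeg s)
  obtain ⟨U', u1', u2', u3', u4'⟩ := exists_free_superset hcol (v := t) (D := D ∪ φ s(y, t))
    (n := ∑ i ∈ I, w s(t, i)) (union_subset hDk (h.sub _))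
    (fun x => disjoint_union_left.2 ⟨hDt x, hφ t x hyt.symm⟩)
    (by rw [card_union_of_disjoint d2]; omega) (by rw [sum_del w ht]; exact hdeg t)
  refine ⟨ψ, U, U', hcol, u2, u2', u3, u3', u4, u4', ?_, ?_⟩
  · rw [← hDc]
    exact card_le_card (subset_inter (subset_union_left.trans u1) (subset_union_left.trans u1'))
  · have : (D ∪ φ s(y, s) ∪ φ s(y, t)).card = L + p + q := by
      rw [card_union_of_disjoint (disjoint_union_left.2 ⟨d2, d3⟩), card_union_of_disjoint d1]
      omega
    rw [← this]
    exact card_le_card (union_subset (u1.trans subset_union_left)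
      ((subset_union_right.trans u1').trans subset_union_right))

/-- Colour one more bundle of parallel edges. -/
theorem IsColoring.update [DecidableEq V] {k : ℕ} {w : Sym2 V → ℕ} {φ : Sym2 V → Finset ℕ}
    (h : IsColoring k w φ)
    {a b : V} {A : Finset ℕ} (hA : A ⊆ range k) (ha : ∀ x, Disjoint A (φ s(a, x)))
    (hb : ∀ x, Disjoint A (φ s(b, x))) :
    IsColoring k (Function.update w s(a, b) A.card) (Function.update φ s(a, b) A) := by
  have key : ∀ e v, v ∈ s(a, b) → v ∈ e → Disjoint A (φ e) := by
    intro e v hv hv'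
    obtain ⟨x, rfl⟩ := Sym2.mem_iff_exists.1 hv'
    rcases Sym2.mem_iff.1 hv with rfl | rfl
    exacts [ha x, hb x]
  refine ⟨fun e => ?_, fun e => ?_, fun e e' v hv hv' hne => ?_⟩
  · rw [Function.update_apply]; split_ifs; exacts [hA, h.sub e]
  · rw [Function.update_apply, Function.update_apply]; split_ifs; exacts [rfl, h.card e]
  · rw [Function.update_apply, Function.update_apply]
    split_ifs with h1 h2 h2
    · exact absurd (h1.trans h2.symm) hne
    · exact key e' v (h1 ▸ hv) hv'
    · exact (key e v (h2 ▸ hv') hv).symm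
    · exact h.disj e e' v hv hv' hne

end WeightedGraph

/-! ### Distributing colours to the edges of a removed part. -/

namespace WeightedGraph

open Finset

/-- Hall's condition for two sets. The set `A` uses up `P \ Q` first, so that it takes as little as
possible from `Q`. -/
theorem exists_disjoint_subsets {P Q : Finset ℕ} {m n : ℕ} (hP : m ≤ P.card) (hQ : n ≤ Q.card)
    (hPQ : m + n ≤ (P ∪ Q).card) :
    ∃ A B, A ⊆ P ∧ B ⊆ Q ∧ A.card = m ∧ B.card = n ∧ Disjoint A B := by
  have h1 := card_sdiff_add_card_inter P Q
  have h2 : (P \ Q).card + Q.card = (P ∪ Q).card := by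
    rw [← card_union_of_disjoint sdiff_disjoint, sdiff_union_self_eq_union]
  obtain ⟨A₁, hA₁, hA₁c⟩ := exists_subset_card_eq (s := P \ Q) (n := min m (P \ Q).card)
    (min_le_right _ _)
  obtain ⟨A, hA₁A, hAP, hAc⟩ := exists_subsuperset_card_eq (hA₁.trans sdiff_subset)
    (show A₁.card ≤ m by rw [hA₁c]; exact min_le_left _ _) hP
  have hAQ : (A ∩ Q).card ≤ m - min m (P \ Q).card := by
    rw [← hA₁c, ← hAc, ← card_sdiff_of_subset hA₁A]
    refine card_le_card fun x hx => ?_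
    rw [mem_inter] at hx
    exact mem_sdiff.2 ⟨hx.1, fun h => (mem_sdiff.1 (hA₁ h)).2 hx.2⟩
  have h3 := card_sdiff_add_card_inter Q A
  rw [inter_comm Q A] at h3
  obtain ⟨B, hB, hBc⟩ := exists_subset_card_eq (s := Q \ A) (n := n) (by
    rcases le_total m (P \ Q).card with h | h <;> simp only [h, min_eq_left, min_eq_right] at hAQ <;>
      omega)
  exact ⟨A, B, hAP, hB.trans sdiff_subset, hAc, hBc,
    disjoint_of_subset_right hB disjoint_sdiff⟩

/-- The colours at two vertices `s` and `t` with two common neighbours can be distributed to the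
four edges if not too many of them are common. -/
theorem exists_split_two {U U' : Finset ℕ} {a b c d : ℕ} (hU : U.card = a + c)
    (hU' : U'.card = b + d) (h : (U ∩ U').card ≤ min a d + min b c) :
    ∃ A B, A ⊆ U ∧ B ⊆ U' ∧ A.card = a ∧ B.card = b ∧ Disjoint A B ∧
      Disjoint (U \ A) (U' \ B) := by
  -- A common colour must go either to `A` and `U' \ B` or to `B` and `U \ A`. The first kind is
  -- `T`, bounded by `min a d`; the remaining common colours are of the second kind.
  obtain ⟨T, hT, hTc⟩ := exists_subset_card_eq (s := U ∩ U')
    (n := min (U ∩ U').card (min a d)) (min_le_left _ _)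
  have hT' : ((U ∩ U') \ T).card + T.card = (U ∩ U').card := by
    rw [card_sdiff_of_subset hT, Nat.sub_add_cancel (card_le_card hT)]
  have hS : (U ∩ U') \ T ⊆ U ∩ U' := sdiff_subset
  have c1 : (U \ ((U ∩ U') \ T)).card + ((U ∩ U') \ T).card = U.card := by
    rw [card_sdiff_of_subset (hS.trans inter_subset_left),
      Nat.sub_add_cancel (card_le_card (hS.trans inter_subset_left))]
  have i1 : T.card ≤ a := by rw [hTc]; omega
  have i2 : T.card ≤ d := by rw [hTc]; omega
  have i3 : ((U ∩ U') \ T).card ≤ b := by omega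
  have i4 : ((U ∩ U') \ T).card ≤ c := by omega
  obtain ⟨A, hTA, hA, hAc⟩ := exists_subsuperset_card_eq (s := T) (t := U \ ((U ∩ U') \ T)) (n := a)
    (fun x hx => by have := hT hx; simp_all) i1 (by omega)
  have c2 : (U' \ T).card + T.card = U'.card := by
    rw [card_sdiff_of_subset (hT.trans inter_subset_right),
      Nat.sub_add_cancel (card_le_card (hT.trans inter_subset_right))]
  obtain ⟨B, hSB, hB, hBc⟩ := exists_subsuperset_card_eq (s := (U ∩ U') \ T) (t := U' \ T) (n := b)
    (fun x hx => by simp_all) i3 (by omega)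
  refine ⟨A, B, hA.trans sdiff_subset, hB.trans sdiff_subset, hAc, hBc, ?_, ?_⟩
  · rw [disjoint_left]
    intro x hx hx'
    have := hA hx
    have := hB hx'
    simp_all
  · rw [disjoint_left]
    intro x hx hx'
    simp only [mem_sdiff] at hx hx'
    by_cases hxT : x ∈ T
    · exact hx.2 (hTA hxT)
    · exact hx'.2 (hSB (by simp [*]))

/-- Arithmetic for `exists_split_three`: `τ` is the number of common colours, and `x`, `x'` count
those placed in `C` and `C'`. The least admissible values `l`, `l'` are tried first; if their sum is
below `τ - f`, then `x` is raised, up to `c`, and after that `x'`. -/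
theorem exists_common_counts {a a' c c' m m' f τ : ℕ} (hm : m ≤ a) (hm' : m' ≤ a')
    (hc : m ≤ c') (hc' : m' ≤ c) (hL : m + m' ≤ τ) (hU : τ ≤ a + c) (hU' : τ ≤ a' + c')
    (hR : τ ≤ a + a') (hf : τ ≤ f + c + c') :
    ∃ x x', x ≤ c ∧ x' ≤ c' ∧ m' ≤ x ∧ m ≤ x' ∧ τ ≤ a + x ∧ τ ≤ a' + x' ∧ x + x' ≤ τ ∧
      τ ≤ f + (x + x') := by
  obtain ⟨l, hl1, hl2, hl3⟩ : ∃ l, m' ≤ l ∧ τ ≤ a + l ∧ (l = m' ∨ l + a = τ) := by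
    rcases le_total τ (m' + a) with h | h
    · exact ⟨m', by omega, by omega, by omega⟩
    · exact ⟨τ - a, by omega, by omega, by omega⟩
  obtain ⟨l', hl1', hl2', hl3'⟩ : ∃ l, m ≤ l ∧ τ ≤ a' + l ∧ (l = m ∨ l + a' = τ) := by
    rcases le_total τ (m + a') with h | h
    · exact ⟨m, by omega, by omega, by omega⟩
    · exact ⟨τ - a', by omega, by omega, by omega⟩
  have e1 : l ≤ c := by omega
  have e2 : l' ≤ c' := by omega
  have e3 : l + l' ≤ τ := by omega
  clear hl3 hl3' hm hm' hL hR hU hU'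
  rcases le_total τ (f + (l + l')) with h | h
  · exact ⟨l, l', by omega, by omega, by omega, by omega, by omega, by omega, by omega, by omega⟩
  rcases le_total τ (f + (c + l')) with h' | h'
  · exact ⟨τ - f - l', l', by omega, by omega, by omega, by omega, by omega,
      by omega, by omega, by omega⟩
  · exact ⟨c, τ - f - c, by omega, by omega, by omega, by omega, by omega,
      by omega, by omega, by omega⟩

/-- Here `a`, `b`, `c` are the multiplicities of `vs`, `vx`, `xs` in a fan, and `a'`, `b'`, `c'`
those of `v't`, `v'x`, `xt`; the sets `C`, `C'`, `B`, `B'` go to `xs`, `xt`, `vx`, `v'x`, and the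
remainders of `U`, `U'` to `vs`, `v't`. The colours forbidden to `B` are `U ∪ C'`, so common colours
in `C'` save room for it, and likewise those in `C` for `B'`; this explains `hL`. As `C` and `C'`
are disjoint, a common colour lies in one of the two remainders, whence `hR`. A common colour is
forbidden to both of the disjoint sets `B` and `B'`, whence `hR'`. -/
theorem exists_split_three {k : ℕ} {U U' : Finset ℕ} {a a' b b' c c' : ℕ}
    (hU : U.card = a + c) (hU' : U'.card = a' + c')
    (t : a + b + c ≤ k) (t' : a' + b' + c' ≤ k) (d : b + b' + c + c' ≤ k)
    (hL : (a + b + c + c' - k) + (a' + b' + c + c' - k) ≤ (U ∩ U').card)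
    (hR : (U ∩ U').card ≤ a + a') (hR' : (U ∩ U').card + b + b' ≤ k) :
    ∃ C C' B B', C ⊆ U ∧ C' ⊆ U' ∧ B ⊆ range k ∧ B' ⊆ range k ∧ C.card = c ∧ C'.card = c' ∧
      B.card = b ∧ B'.card = b' ∧ Disjoint C C' ∧ Disjoint B B' ∧ Disjoint B U ∧ Disjoint B C' ∧
      Disjoint B' U' ∧ Disjoint B' C := by
  have s1 := card_sdiff_add_card_inter U U'
  have s2 := card_sdiff_add_card_inter U' U
  rw [inter_comm U' U] at s2
  obtain ⟨x, x', h1, h2, h3, h4, h5, h6, h7, h8⟩ := exists_common_counts (τ := (U ∩ U').card)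
    (a := a) (a' := a') (c := c) (c' := c') (m := a + b + c + c' - k) (m' := a' + b' + c + c' - k)
    (f := k - b - b' - c - c') (by omega) (by omega) (by omega) (by omega) hL (by omega) (by omega)
    hR (by omega)
  replace h3 : a' + b' + c + c' ≤ k + x := by omega
  replace h4 : a + b + c + c' ≤ k + x' := by omega
  replace h8 : (U ∩ U').card + b + b' + c + c' ≤ k + (x + x') := by omega
  clear hL hR hR' d t t'
  obtain ⟨X, hX, hXc⟩ := exists_subset_card_eq (s := U ∩ U') (n := x) (by omega)
  obtain ⟨X', hX', hXc'⟩ := exists_subset_card_eq (s := (U ∩ U') \ X) (n := x')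
    (by rw [card_sdiff_of_subset hX]; omega)
  obtain ⟨Y, hY, hYc⟩ := exists_subset_card_eq (s := U \ U') (n := c - x) (by omega)
  obtain ⟨Y', hY', hYc'⟩ := exists_subset_card_eq (s := U' \ U) (n := c' - x') (by omega)
  simp only [subset_iff, mem_inter, mem_sdiff] at hX hX' hY hY'
  have dXY : Disjoint X Y := disjoint_left.2 fun z hz hz' => (hY hz').2 (hX hz).2
  have dXY' : Disjoint X' Y' := disjoint_left.2 fun z hz hz' => (hY' hz').2 (hX' hz).1.1
  have hC : (X ∪ Y).card = c := by rw [card_union_of_disjoint dXY]; omega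
  have hC' : (X' ∪ Y').card = c' := by rw [card_union_of_disjoint dXY']; omega
  have hCU : X ∪ Y ⊆ U := by
    intro z hz
    rcases mem_union.1 hz with h | h
    exacts [(hX h).1, (hY h).1]
  have hCU' : X' ∪ Y' ⊆ U' := by
    intro z hz
    rcases mem_union.1 hz with h | h
    exacts [(hX' h).1.2, (hY' h).1]
  have k1 : (U ∪ (X' ∪ Y')).card ≤ a + c + (c' - x') := by
    have : U ∪ (X' ∪ Y') ⊆ U ∪ Y' := by
      intro z hz
      simp only [mem_union] at hz ⊢
      rcases hz with h | h | h
      exacts [.inl h, .inl (hX' h).1.1, .inr h]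
    have := (card_le_card this).trans (card_union_le _ _)
    omega
  have k2 : (U' ∪ (X ∪ Y)).card ≤ a' + c' + (c - x) := by
    have : U' ∪ (X ∪ Y) ⊆ U' ∪ Y := by
      intro z hz
      simp only [mem_union] at hz ⊢
      rcases hz with h | h | h
      exacts [.inl h, .inl (hX h).2, .inr h]
    have := (card_le_card this).trans (card_union_le _ _)
    omega
  have k3 : ((U ∪ (X' ∪ Y')) ∩ (U' ∪ (X ∪ Y))).card ≤ (U ∩ U').card + ((c - x) + (c' - x')) := by
    have : (U ∪ (X' ∪ Y')) ∩ (U' ∪ (X ∪ Y)) ⊆ U ∩ U' ∪ (Y ∪ Y') := by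
      intro z hz
      simp only [mem_inter, mem_union] at hz ⊢
      have := @hX z
      have := @hX' z
      have := @hY z
      have := @hY' z
      tauto
    have := (card_le_card this).trans (card_union_le _ _)
    have := card_union_le Y Y'
    omega
  have l1 := le_card_sdiff (U ∪ (X' ∪ Y')) (range k)
  have l2 := le_card_sdiff (U' ∪ (X ∪ Y)) (range k)
  have l3 := le_card_sdiff ((U ∪ (X' ∪ Y')) ∩ (U' ∪ (X ∪ Y))) (range k)
  rw [card_range] at l1 l2 l3
  rw [sdiff_inter_distrib_right] at l3
  -- The three cardinality conditions are `h4`, `h3` and `h8`; the colours forbidden to both are,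
  -- apart from common ones, only those of `Y` and `Y'`.
  obtain ⟨B, B', hB, hB', hBc, hBc', hBB'⟩ := exists_disjoint_subsets (m := b) (n := b')
    (P := range k \ (U ∪ (X' ∪ Y'))) (Q := range k \ (U' ∪ (X ∪ Y))) (by omega) (by omega)
    (by omega)
  have dB : Disjoint B (U ∪ (X' ∪ Y')) := disjoint_of_subset_left hB sdiff_disjoint
  have dB' : Disjoint B' (U' ∪ (X ∪ Y)) := disjoint_of_subset_left hB' sdiff_disjoint
  refine ⟨X ∪ Y, X' ∪ Y', B, B', hCU, hCU', hB.trans sdiff_subset, hB'.trans sdiff_subset, hC, hC',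
    hBc, hBc', ?_, hBB', (disjoint_union_right.1 dB).1, (disjoint_union_right.1 dB).2,
    (disjoint_union_right.1 dB').1, (disjoint_union_right.1 dB').2⟩
  rw [disjoint_left]
  intro z hz hz'
  simp only [mem_union] at hz hz'
  have := @hX z
  have := @hX' z
  have := @hY z
  have := @hY' z
  tauto

theorem disjoint_update {V : Type*} [DecidableEq V] {φ : Sym2 V → Finset ℕ} {a c d : V}
    {A B : Finset ℕ} (h : ∀ x, Disjoint A (φ s(a, x))) (hB : a = c ∨ a = d → Disjoint A B) (x : V) :
    Disjoint A (Function.update φ s(c, d) B s(a, x)) := by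
  rw [Function.update_apply]
  split_ifs with h'
  · refine hB ?_
    have : a ∈ s(c, d) := h' ▸ Sym2.mem_mk_left a x
    simpa using this
  · exact h x

/-- The last clause makes the gadget enforce `hR` and `hR'` of `exists_split_three`; the
disjunctions are what the odd sets through `y` require. If the sizes of `U` and `U'` already enforce
both, `p = q = 0`. Otherwise the tighter of the two bounds prescribes the sum: `L + p + q` is `c +
c'` if `a + a'` is at most `k - b - b'`, and `a + a' + b + b' + c + c' - k` otherwise. The sum is
then split so that neither `p` nor `q` is too large. -/
theorem exists_gadget_parameters {k a a' b b' c c' : ℕ}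
    (t : a + b + c ≤ k) (t' : a' + b' + c' ≤ k) (d : b + b' + c + c' ≤ k) {L : ℕ}
    (hL : L = (a + b + c + c' - k) + (a' + b' + c + c' - k)) :
    ∃ p q, L + p ≤ a + c ∧ L + q ≤ a' + c' ∧ p + q ≤ k ∧ (p ≤ c ∨ p ≤ a) ∧ (q ≤ c' ∨ q ≤ a') ∧
      (L + p + q ≤ c + c' ∨ L + p + q + k ≤ a + a' + b + b' + c + c') ∧
      ∀ τ, τ ≤ a + c → τ ≤ a' + c' → τ + (L + p + q) ≤ a + c + (a' + c') →
        τ ≤ a + a' ∧ τ + b + b' ≤ k := by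
  have h1 : a + b + c + c' - k ≤ c' := by omega
  have h2 : a' + b' + c + c' - k ≤ c := by omega
  have h3 : a + b + c + c' - k ≤ a := by omega
  have h4 : a' + b' + c + c' - k ≤ a' := by omega
  by_cases g1 : min (a + c) (a' + c') ≤ a + a' ∧ min (a + c) (a' + c') + b + b' ≤ k
  · refine ⟨0, 0, by omega, by omega, by omega, by omega, by omega, by omega, fun τ _ _ _ => ?_⟩
    have : τ ≤ min (a + c) (a' + c') := le_min ‹_› ‹_›
    omega
  rw [not_and_or, not_le, not_le] at g1
  have g2 : min (a + c) (a' + c') ≤ a + c := min_le_left _ _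
  have g3 : min (a + c) (a' + c') ≤ a' + c' := min_le_right _ _
  generalize min (a + c) (a' + c') = m at *
  rcases le_total (a + a' + b + b') k with g | g
  · have g5 : a' ≤ m := by omega
    rcases le_total c (a + c - L) with h | h
    · exact ⟨c, c' - L, by omega, by omega, by omega, by omega, by omega, by omega,
        fun τ _ _ _ => by omega⟩
    · exact ⟨a + c - L, c' - a, by omega, by omega, by omega, by omega, by omega, by omega,
        fun τ _ _ _ => by omega⟩
  · rcases le_total a (a + c - L) with h | h
    · exact ⟨a, a' + b + b' + c + c' - k - L, by omega, by omega, by omega, by omega, by omega,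
        by omega, fun τ _ _ _ => by omega⟩
    · exact ⟨a + c - L, a' + b + b' + c' - k, by omega, by omega, by omega, by omega, by omega,
        by omega, fun τ _ _ _ => by omega⟩

end WeightedGraph

/-! ### Reducing twins and fans. -/

namespace WeightedGraph

open Finset

variable {V : Type*} [DecidableEq V] [Fintype V]

theorem even_insert_bound {k : ℕ} {w : Sym2 V → ℕ} (hw : IsBounded k w) {Y : Finset V} {x : V}
    (hx : x ∉ Y) (hY : Even Y.card) : degSumOn w Y + 2 * ∑ u ∈ Y, w s(x, u) ≤ k * Y.card := by
  have h := hw.odd (insert x Y) (by rw [card_insert_of_notMem hx]; exact hY.add_one)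
  rw [degSumOn_insert w hx, card_insert_of_notMem hx, hw.diag, mul_add_one] at h
  omega

theorem odd_insert_two_bound {k : ℕ} {w : Sym2 V → ℕ} (hw : IsBounded k w) {Y : Finset V} {x v : V}
    (hx : x ∉ Y) (hv : v ∉ Y) (hvx : v ≠ x) (hY : Odd Y.card) :
    degSumOn w Y + 2 * (∑ u ∈ Y, w s(x, u) + ∑ u ∈ Y, w s(v, u) + w s(v, x)) ≤ k * Y.card + k := by
  have hv' : v ∉ insert x Y := by simp [hvx, hv]
  have h := even_insert_bound hw (Y := insert x Y) hv'
    (by rw [card_insert_of_notMem hx]; exact hY.add_one)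
  rw [degSumOn_insert w hx, card_insert_of_notMem hx, hw.diag, sum_insert hx, mul_add_one] at h
  omega

theorem even_insert_three_bound {k : ℕ} {w : Sym2 V → ℕ} (hw : IsBounded k w) {Y : Finset V}
    {x v v' : V} (hx : x ∉ Y) (hv : v ∉ Y) (hv' : v' ∉ Y) (hvx : v ≠ x) (hvx' : v' ≠ x)
    (hvv' : v ≠ v') (hY : Even Y.card) :
    degSumOn w Y + 2 * (∑ u ∈ Y, w s(x, u) + ∑ u ∈ Y, w s(v, u) + ∑ u ∈ Y, w s(v', u) +
      w s(v, x) + w s(v', x) + w s(v, v')) ≤ k * Y.card + 2 * k := by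
  have h := odd_insert_two_bound hw (Y := insert x Y) (x := v') (v := v) (by simp [hvx', hv'])
    (by simp [hvx, hv]) hvv' (by rw [card_insert_of_notMem hx]; exact hY.add_one)
  rw [degSumOn_insert w hx, card_insert_of_notMem hx, hw.diag, sum_insert hx, sum_insert hx,
    mul_add_one] at h
  omega

/-- The odd set bound for `Y` without `s` and `t`, combined with the degree bounds at `s` and `t`:
edges into `I` are unavailable inside `Y`. -/
theorem odd_erase_two_bound {k : ℕ} {w : Sym2 V → ℕ} (hw : IsBounded k w) {Y I : Finset V}
    {s t : V} (hYI : Disjoint Y I) (hs : s ∈ Y) (ht : t ∈ Y) (hst : s ≠ t) (hY : Odd Y.card) :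
    degSumOn w Y + 2 * (∑ j ∈ I, w s(s, j) + ∑ j ∈ I, w s(t, j)) + k ≤ k * Y.card + 2 * k := by
  have hs' : s ∈ Y.erase t := mem_erase.2 ⟨hst, hs⟩
  have c1 := card_erase_add_one ht
  have c2 := card_erase_add_one hs'
  have i1 := degSumOn_insert w (notMem_erase t Y)
  have i2 := degSumOn_insert w (notMem_erase s (Y.erase t))
  rw [insert_erase ht, hw.diag] at i1
  rw [insert_erase hs', hw.diag] at i2
  have h := hw.odd ((Y.erase t).erase s) (by
    rw [← c1, ← c2] at hY
    simpa [Nat.odd_add] using hY)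
  have d : ∀ v, ∀ Y' ⊆ Y, ∑ u ∈ Y', w s(v, u) + ∑ j ∈ I, w s(v, j) ≤ k := by
    intro v Y' hY'
    rw [← sum_union (disjoint_of_subset_left hY' hYI)]
    exact (sum_le_sum_of_subset (subset_univ _)).trans (hw.deg v)
  have d1 := d t _ (erase_subset t Y)
  have d2 := d s _ ((erase_subset s _).trans (erase_subset t Y))
  rw [← c1, ← c2, mul_add_one, mul_add_one]
  omega

/-- A triangle has at most `k` edges. -/
theorem IsBounded.triangle {k : ℕ} {w : Sym2 V → ℕ} (hw : IsBounded k w) {x y z : V}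
    (hxy : x ≠ y) (hxz : x ≠ z) (hyz : y ≠ z) : w s(x, y) + w s(y, z) + w s(x, z) ≤ k := by
  have h := odd_insert_two_bound hw (Y := {z}) (x := y) (v := x) (by simpa) (by simpa) hxy
    (by simp)
  simp only [degSumOn, sum_singleton, hw.diag, card_singleton] at h
  omega

theorem sum_four_le {f : V → ℕ} {k : ℕ} (h : ∑ u, f u ≤ k) {a b c d : V} (hab : a ≠ b)
    (hac : a ≠ c) (had : a ≠ d) (hbc : b ≠ c) (hbd : b ≠ d) (hcd : c ≠ d) :
    f a + f b + f c + f d ≤ k := by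
  have : ∑ u ∈ {a, b, c, d}, f u ≤ ∑ u, f u := sum_le_sum_of_subset (subset_univ _)
  rw [sum_insert (by simp [*]), sum_insert (by simp [*]), sum_insert (by simp [*]),
    sum_singleton] at this
  omega

omit [DecidableEq V] [Fintype V] in
theorem IsColoring.congr {k : ℕ} {w w' : Sym2 V → ℕ} {φ : Sym2 V → Finset ℕ}
    (h : IsColoring k w φ) (hw : w = w') : IsColoring k w' φ := hw ▸ h

/-- Reduction of two vertices `v`, `v'` with the same two neighbours `s`, `t`. -/
theorem exists_coloring_of_twins {k : ℕ} {w : Sym2 V → ℕ} (hw : IsBounded k w) {v v' s t : V}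
    (hvv : v ≠ v') (hvs : v ≠ s) (hvt : v ≠ t) (hvs' : v' ≠ s) (hvt' : v' ≠ t) (hst : s ≠ t)
    (hv : ∀ x, x ≠ s → x ≠ t → w s(v, x) = 0) (hv' : ∀ x, x ≠ s → x ≠ t → w s(v', x) = 0)
    (ih : ∀ L p q, IsBounded k (gadget w {v, v'} v s t L p q) →
      ∃ φ, IsColoring k (gadget w {v, v'} v s t L p q) φ) :
    ∃ φ, IsColoring k w φ := by
  have hvI : v ∈ ({v, v'} : Finset V) := by simp
  have hsI : s ∉ ({v, v'} : Finset V) := by simp [hvs.symm, hvs'.symm]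
  have htI : t ∉ ({v, v'} : Finset V) := by simp [hvt.symm, hvt'.symm]
  have sums : ∀ x, ∑ i ∈ {v, v'}, w s(x, i) = w s(v, x) + w s(v', x) := fun x => by
    rw [sum_pair hvv, Sym2.eq_swap, Sym2.eq_swap (b := v')]
  have dis : ∀ Y : Finset V, Disjoint Y {v, v'} → v ∉ Y ∧ v' ∉ Y := fun Y h => by simpa using h
  have nb := fun Y : Finset V => sum_eq_of_two_neighbours w hst (Y := Y) fun x _ => hv x
  have nb' := fun Y : Finset V => sum_eq_of_two_neighbours w hst (Y := Y) fun x _ => hv' x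
  have hdeg : w s(v, s) + w s(v, t) ≤ k := by
    have := hw.deg v
    simpa [nb] using this
  have hdeg' : w s(v', s) + w s(v', t) ≤ k := by
    have := hw.deg v'
    simpa [nb'] using this
  -- The sum of minima is the size of `U` or of `U'` in two of the four cases, and nothing has to be
  -- enforced. In the other two it consists of the edges of one twin, and the gadget keeps the other
  -- twin as it is.
  obtain ⟨p, q, hp, hq, hpq, hb, hR⟩ : ∃ p q, p ≤ w s(v, s) + w s(v', s) ∧
      q ≤ w s(v, t) + w s(v', t) ∧ p + q ≤ k ∧
      ((p ≤ w s(v, s) ∧ q ≤ w s(v, t)) ∨ (p ≤ w s(v', s) ∧ q ≤ w s(v', t))) ∧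
      ∀ τ, τ ≤ w s(v, s) + w s(v', s) → τ ≤ w s(v, t) + w s(v', t) →
        τ + (p + q) ≤ w s(v, s) + w s(v', s) + (w s(v, t) + w s(v', t)) →
        τ ≤ min (w s(v, s)) (w s(v', t)) + min (w s(v, t)) (w s(v', s)) := by
    rcases le_total (w s(v, s)) (w s(v', t)) with h | h <;>
      rcases le_total (w s(v, t)) (w s(v', s)) with h' | h' <;>
      simp only [h, h', min_eq_left, min_eq_right]
    · exact ⟨w s(v', s), w s(v', t), by omega, by omega, by omega, by omega,
        fun τ _ _ _ => by omega⟩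
    · exact ⟨0, 0, by omega, by omega, by omega, by omega, fun τ _ _ _ => by omega⟩
    · exact ⟨0, 0, by omega, by omega, by omega, by omega, fun τ _ _ _ => by omega⟩
    · exact ⟨w s(v, s), w s(v, t), by omega, by omega, by omega, by omega,
        fun τ _ _ _ => by omega⟩
  have hE : ∀ Y : Finset V, Disjoint Y {v, v'} → Even Y.card →
      degSumOn w Y + 2 * ((if s ∈ Y then p else 0) + (if t ∈ Y then q else 0)) ≤ k * Y.card := by
    intro Y hY hYe
    have h1 := even_insert_bound hw (dis Y hY).1 hYe
    have h2 := even_insert_bound hw (dis Y hY).2 hYe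
    rw [nb] at h1
    rw [nb'] at h2
    split_ifs at * <;> omega
  obtain ⟨φ, hφ⟩ := ih 0 p q (hw.gadget hvI hsI htI hst (by rw [sums]; omega) (by rw [sums]; omega)
    hpq (fun Y _ hY _ _ => by have := hw.odd Y hY; omega)
    (fun Y hY hYe h1 h2 => by have := hE Y hY hYe; simp only [h1, h2, if_true] at this; omega)
    (fun Y hY hYe h1 h2 => by
      have := hE Y hY hYe; simp only [h1, h2, if_true, if_false] at this; omega)
    (fun Y hY hYe h1 h2 => by
      have := hE Y hY hYe; simp only [h1, h2, if_true, if_false] at this; omega))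
  obtain ⟨ψ, U, U', hψ, hUk, hUk', hU, hU', hUs, hUt, -, hUU⟩ := hφ.exists_of_gadget hw.deg hvI hsI
    htI hst (by rw [sums]; omega) (by rw [sums]; omega)
  rw [sums] at hU hU'
  have hun := card_union_add_card_inter U U'
  obtain ⟨A, B, hA, hB, hAc, hBc, hAB, hCD⟩ := exists_split_two hU hU'
    (hR _ (hU ▸ card_le_card inter_subset_left) (hU' ▸ card_le_card inter_subset_right)
      (by omega))
  have h0 : ∀ (X : Finset ℕ) x, Disjoint X (ψ s(v, x)) := fun X x => by
    rw [card_eq_zero.1 ((hψ.card _).trans (del_eq_zero w hvI x))]; simp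
  have h0' : ∀ (X : Finset ℕ) x, Disjoint X (ψ s(v', x)) := fun X x => by
    rw [card_eq_zero.1 ((hψ.card _).trans (del_eq_zero w (by simp) x))]; simp
  have hs : ∀ X ⊆ U, ∀ x, Disjoint X (ψ s(s, x)) := fun X hX x => (hUs x).mono_left hX
  have ht : ∀ X ⊆ U', ∀ x, Disjoint X (ψ s(t, x)) := fun X hX x => (hUt x).mono_left hX
  have hAC : Disjoint (U \ A) A := sdiff_disjoint
  have hBD : Disjoint (U' \ B) B := sdiff_disjoint
  have r1 := hψ.update (a := v) (b := s) (A := A) (hA.trans hUk) (h0 A) (hs A hA)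
  have r2 := r1.update (a := v') (b := s) (A := U \ A) (sdiff_subset.trans hUk)
    (disjoint_update (h0' _) fun _ => hAC) (disjoint_update (hs _ sdiff_subset) fun _ => hAC)
  have r3 := r2.update (a := v) (b := t) (A := B) (hB.trans hUk')
    (disjoint_update (disjoint_update (h0 _) fun _ => hAB.symm) (by simp [hvv, hvs]))
    (disjoint_update (disjoint_update (ht _ hB) (by simp [hvt.symm, hst.symm]))
      (by simp [hvt'.symm, hst.symm]))
  have r4 := r3.update (a := v') (b := t) (A := U' \ B) (sdiff_subset.trans hUk')
    (disjoint_update (disjoint_update (disjoint_update (h0' _) (by simp [hvv.symm, hvs']))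
      fun _ => hCD.symm) (by simp [hvv.symm, hvt']))
    (disjoint_update (disjoint_update (disjoint_update (ht _ sdiff_subset)
      (by simp [hvt.symm, hst.symm])) (by simp [hvt'.symm, hst.symm])) fun _ => hBD)
  refine ⟨_, r4.congr ?_⟩
  funext e
  simp only [Function.update_apply]
  have c3 := card_sdiff_of_subset hA
  have c4 := card_sdiff_of_subset hB
  split_ifs with g1 g2 g3 g4
  · rw [g1]; omega
  · rw [g2]; omega
  · rw [g3]; omega
  · rw [g4]; omega
  · by_cases g : ∃ i ∈ ({v, v'} : Finset V), i ∈ e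
    · obtain ⟨i, hi, hie⟩ := g
      obtain ⟨x, rfl⟩ := Sym2.mem_iff_exists.1 hie
      rw [del_eq_zero w hi]
      rcases mem_insert.1 hi with rfl | hi
      · exact (hv x (by rintro rfl; exact g4 rfl) (by rintro rfl; exact g2 rfl)).symm
      · rw [mem_singleton] at hi
        subst hi
        exact (hv' x (by rintro rfl; exact g3 rfl) (by rintro rfl; exact g1 rfl)).symm
    · exact if_neg g

/-- Reduction of a vertex `x` with neighbours `s`, `t`, `v`, `v'`, where `v` has the neighbours `x`,
`s` and `v'` has the neighbours `x`, `t`. -/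
theorem exists_coloring_of_fan {k : ℕ} {w : Sym2 V → ℕ} (hw : IsBounded k w) {x v v' s t : V}
    (hxv : x ≠ v) (hxv' : x ≠ v') (hxs : x ≠ s) (hxt : x ≠ t)
    (hvv : v ≠ v') (hvs : v ≠ s) (hvt : v ≠ t) (hvs' : v' ≠ s) (hvt' : v' ≠ t) (hst : s ≠ t)
    (hx : ∀ y, y ≠ s → y ≠ t → y ≠ v → y ≠ v' → w s(x, y) = 0)
    (hv : ∀ y, y ≠ x → y ≠ s → w s(v, y) = 0) (hv' : ∀ y, y ≠ x → y ≠ t → w s(v', y) = 0)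
    (ih : ∀ L p q, IsBounded k (gadget w {x, v, v'} x s t L p q) →
      ∃ φ, IsColoring k (gadget w {x, v, v'} x s t L p q) φ) :
    ∃ φ, IsColoring k w φ := by
  have hxI : x ∈ ({x, v, v'} : Finset V) := by simp
  have hsI : s ∉ ({x, v, v'} : Finset V) := by simp [hvs.symm, hvs'.symm, hxs.symm]
  have htI : t ∉ ({x, v, v'} : Finset V) := by simp [hvt.symm, hvt'.symm, hxt.symm]
  have sumI : ∀ y, ∑ i ∈ {x, v, v'}, w s(y, i) = w s(x, y) + w s(v, y) + w s(v', y) := fun y => by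
    rw [sum_insert (by simp [*]), sum_pair hvv, Sym2.eq_swap, Sym2.eq_swap (b := v),
      Sym2.eq_swap (b := v'), add_assoc]
  have z1 : w s(v', s) = 0 := hv' s hxs.symm hst
  have z2 : w s(v, t) = 0 := hv t hxt.symm hst.symm
  have z3 : w s(v, v') = 0 := hv v' hxv'.symm hvs'
  have dis : ∀ Y : Finset V, Disjoint Y {x, v, v'} → x ∉ Y ∧ v ∉ Y ∧ v' ∉ Y := fun Y h => by
    simpa using h
  have nb : ∀ Y : Finset V, Disjoint Y {x, v, v'} → ∑ u ∈ Y, w s(x, u) =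
      (if s ∈ Y then w s(x, s) else 0) + (if t ∈ Y then w s(x, t) else 0) := fun Y hY =>
    sum_eq_of_two_neighbours w hst fun y hy h1 h2 => hx y h1 h2
      (fun h => (dis Y hY).2.1 (h ▸ hy)) (fun h => (dis Y hY).2.2 (h ▸ hy))
  have nv : ∀ Y : Finset V, Disjoint Y {x, v, v'} → ∑ u ∈ Y, w s(v, u) =
      (if s ∈ Y then w s(v, s) else 0) := fun Y hY => by
    rw [sum_eq_of_two_neighbours w hst fun y hy h1 h2 => hv y (fun h => (dis Y hY).1 (h ▸ hy)) h1,
      z2, ite_self, add_zero]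
  have nv' : ∀ Y : Finset V, Disjoint Y {x, v, v'} → ∑ u ∈ Y, w s(v', u) =
      (if t ∈ Y then w s(v', t) else 0) := fun Y hY => by
    rw [sum_eq_of_two_neighbours w hst fun y hy h1 h2 => hv' y (fun h => (dis Y hY).1 (h ▸ hy)) h2,
      z1, ite_self, zero_add]
  have t1 : w s(v, s) + w s(v, x) + w s(x, s) ≤ k := by
    have := hw.triangle hxv.symm hvs hxs
    omega
  have t2 : w s(v', t) + w s(v', x) + w s(x, t) ≤ k := by
    have := hw.triangle hxv'.symm hvt' hxt
    omega
  have d : w s(v, x) + w s(v', x) + w s(x, s) + w s(x, t) ≤ k := by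
    have := sum_four_le (hw.deg x) hvv hvs hvt hvs' hvt' hst
    rwa [Sym2.eq_swap, Sym2.eq_swap (b := v')] at this
  -- The number of common colours demanded by `exists_split_three`, with truncated differences.
  obtain ⟨L, hL⟩ : ∃ L, L = (w s(v, s) + w s(v, x) + w s(x, s) + w s(x, t) - k) +
    (w s(v', t) + w s(v', x) + w s(x, s) + w s(x, t) - k) := ⟨_, rfl⟩
  obtain ⟨p, q, hp, hq, hpq, hp', hq', hpqL, hτ⟩ := exists_gadget_parameters t1 t2 d hL
  have hLp : L + p ≤ ∑ i ∈ {x, v, v'}, w s(s, i) := by rw [sumI]; omega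
  have hLq : L + q ≤ ∑ i ∈ {x, v, v'}, w s(t, i) := by rw [sumI]; omega
  obtain ⟨φ, hφ⟩ : ∃ φ, IsColoring k (gadget w {x, v, v'} x s t L p q) φ := by
    refine ih L p q (hw.gadget hxI hsI htI hst hLp hLq hpq ?_ ?_ ?_ ?_)
    · intro Y hY hYo h1 h2
      obtain ⟨n1, n2, n3⟩ := dis Y hY
      -- If both differences in `L` vanish, `b1` suffices; if only one is positive, `b2` or `b3`; if
      -- both are, `b4` together with the degree bound at `x`.
      have b1 := hw.odd Y hYo
      have b2 := odd_insert_two_bound hw n1 n2 hxv.symm hYo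
      have b3 := odd_insert_two_bound hw n1 n3 hxv'.symm hYo
      have b4 := odd_erase_two_bound hw hY h1 h2 hst hYo
      rw [sumI, sumI] at b4
      simp only [nb Y hY, nv Y hY, nv' Y hY, h1, h2, if_true] at b2 b3
      clear hp hq hp' hq' hpq hpqL hτ hLp hLq
      omega
    · intro Y hY hYe h1 h2
      obtain ⟨n1, n2, n3⟩ := dis Y hY
      -- The two alternatives in `hpqL` correspond to adding `x` alone or the whole fan to `Y`.
      have b1 := even_insert_bound hw n1 hYe
      have b2 := even_insert_three_bound hw n1 n2 n3 hxv.symm hxv'.symm hvv hYe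
      simp only [nb Y hY, nv Y hY, nv' Y hY, h1, h2, if_true, z3] at b1 b2
      omega
    · intro Y hY hYe h1 h2
      obtain ⟨n1, n2, n3⟩ := dis Y hY
      have b1 := even_insert_bound hw n1 hYe
      have b2 := even_insert_bound hw n2 hYe
      simp only [nb Y hY, nv Y hY, h1, h2, if_true, if_false] at b1 b2
      omega
    · intro Y hY hYe h1 h2
      obtain ⟨n1, n2, n3⟩ := dis Y hY
      have b1 := even_insert_bound hw n1 hYe
      have b2 := even_insert_bound hw n3 hYe
      simp only [nb Y hY, nv' Y hY, h1, h2, if_true, if_false] at b1 b2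
      omega
  obtain ⟨ψ, U, U', hψ, hUk, hUk', hU, hU', hUs, hUt, hUL, hUU⟩ := hφ.exists_of_gadget hw.deg hxI
    hsI htI hst hLp hLq
  have hun := card_union_add_card_inter U U'
  rw [sumI] at hU hU'
  replace hU : U.card = w s(v, s) + w s(x, s) := by omega
  replace hU' : U'.card = w s(v', t) + w s(x, t) := by omega
  obtain ⟨hR, hR'⟩ := hτ _ (hU ▸ card_le_card inter_subset_left)
    (hU' ▸ card_le_card inter_subset_right) (by omega)
  obtain ⟨C, C', B, B', hC, hC', hB, hB', hCc, hCc', hBc, hBc', hCC, hBB, hBU, hBC, hBU', hBC'⟩ :=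
    exists_split_three hU hU' t1 t2 d (hL ▸ hUL) hR hR'
  have h0 : ∀ i ∈ ({x, v, v'} : Finset V), ∀ (X : Finset ℕ) y, Disjoint X (ψ s(i, y)) :=
    fun i hi X y => by
      rw [card_eq_zero.1 ((hψ.card _).trans (del_eq_zero w hi y))]; simp
  have h0x := h0 x (by simp)
  have h0v := h0 v (by simp)
  have h0v' := h0 v' (by simp)
  have hs : ∀ X ⊆ U, ∀ y, Disjoint X (ψ s(s, y)) := fun X hX y => (hUs y).mono_left hX
  have ht : ∀ X ⊆ U', ∀ y, Disjoint X (ψ s(t, y)) := fun X hX y => (hUt y).mono_left hX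
  have r1 := hψ.update (a := x) (b := s) (A := C) (hC.trans hUk) (h0x C) (hs C hC)
  have r2 := r1.update (a := x) (b := t) (A := C') (hC'.trans hUk')
    (disjoint_update (h0x _) fun _ => hCC.symm)
    (disjoint_update (ht _ hC') (by simp [hxt.symm, hst.symm]))
  have r3 := r2.update (a := v) (b := s) (A := U \ C) (sdiff_subset.trans hUk)
    (disjoint_update (disjoint_update (h0v _) (by simp [hxv.symm, hvs]))
      (by simp [hxv.symm, hvt]))
    (disjoint_update (disjoint_update (hs _ sdiff_subset) fun _ => sdiff_disjoint)
      (by simp [hxs.symm, hst]))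
  have r4 := r3.update (a := v') (b := t) (A := U' \ C') (sdiff_subset.trans hUk')
    (disjoint_update (disjoint_update (disjoint_update (h0v' _) (by simp [hxv'.symm, hvs']))
      (by simp [hxv'.symm, hvt'])) (by simp [hvv.symm, hvs']))
    (disjoint_update (disjoint_update (disjoint_update (ht _ sdiff_subset)
      (by simp [hxt.symm, hst.symm])) fun _ => sdiff_disjoint) (by simp [hvt.symm, hst.symm]))
  have r5 := r4.update (a := v) (b := x) (A := B) hB
    (disjoint_update (disjoint_update (disjoint_update (disjoint_update (h0v _)
      (by simp [hxv.symm, hvs])) (by simp [hxv.symm, hvt]))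
      fun _ => hBU.mono_right sdiff_subset) (by simp [hvv, hvt]))
    (disjoint_update (disjoint_update (disjoint_update (disjoint_update (h0x _)
      fun _ => hBU.mono_right hC) fun _ => hBC) (by simp [hxv, hxs])) (by simp [hxv', hxt]))
  have r6 := r5.update (a := v') (b := x) (A := B') hB'
    (disjoint_update (disjoint_update (disjoint_update (disjoint_update (disjoint_update (h0v' _)
      (by simp [hxv'.symm, hvs'])) (by simp [hxv'.symm, hvt'])) (by simp [hvv.symm, hvs']))
      fun _ => hBU'.mono_right sdiff_subset) fun _ => hBB.symm)
    (disjoint_update (disjoint_update (disjoint_update (disjoint_update (disjoint_update (h0x _)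
      fun _ => hBC') fun _ => hBU'.mono_right hC') (by simp [hxv, hxs])) (by simp [hxv', hxt]))
      fun _ => hBB.symm)
  refine ⟨_, r6.congr ?_⟩
  funext e
  simp only [Function.update_apply]
  have c3 := card_sdiff_of_subset hC
  have c4 := card_sdiff_of_subset hC'
  split_ifs with g1 g2 g3 g4 g5 g6
  · rw [g1]; omega
  · rw [g2]; omega
  · rw [g3]; omega
  · rw [g4]; omega
  · rw [g5]; omega
  · rw [g6]; omega
  · by_cases g : ∃ i ∈ ({x, v, v'} : Finset V), i ∈ e
    · obtain ⟨i, hi, hie⟩ := g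
      obtain ⟨y, rfl⟩ := Sym2.mem_iff_exists.1 hie
      rw [del_eq_zero w hi]
      rcases mem_insert.1 hi with rfl | hi
      · exact (hx y (by rintro rfl; exact g6 rfl) (by rintro rfl; exact g5 rfl)
          (by rintro rfl; exact g2 Sym2.eq_swap) (by rintro rfl; exact g1 Sym2.eq_swap)).symm
      rcases mem_insert.1 hi with rfl | hi
      · exact (hv y (by rintro rfl; exact g2 rfl) (by rintro rfl; exact g4 rfl)).symm
      · rw [mem_singleton] at hi
        subst hi
        exact (hv' y (by rintro rfl; exact g1 rfl) (by rintro rfl; exact g3 rfl)).symm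
    · exact if_neg g

/-- All edges meet pairwise, and the odd set `{x, y, z}` bounds their number by `k`, so all colours
can be distinct. -/
theorem exists_coloring_of_triangle {k : ℕ} {w : Sym2 V → ℕ} (hw : IsBounded k w) {x y z : V}
    (hxy : x ≠ y) (hxz : x ≠ z) (hyz : y ≠ z)
    (h : ∀ e, e ≠ s(x, y) → e ≠ s(y, z) → e ≠ s(x, z) → w e = 0) : ∃ φ, IsColoring k w φ := by
  have t := hw.triangle hxy hxz hyz
  obtain ⟨A, hA, hAc⟩ := exists_subset_card_eq (s := range k) (n := w s(x, y))
    (by rw [card_range]; omega)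
  obtain ⟨B, hB, hBc⟩ := exists_subset_card_eq (s := range k \ A) (n := w s(y, z))
    (by rw [card_sdiff_of_subset hA, card_range]; omega)
  obtain ⟨C, hC, hCc⟩ := exists_subset_card_eq (s := (range k \ A) \ B) (n := w s(x, z))
    (by rw [card_sdiff_of_subset hB, card_sdiff_of_subset hA, card_range]; omega)
  have hBA : Disjoint B A := disjoint_of_subset_left hB sdiff_disjoint
  have hCB : Disjoint C B := disjoint_of_subset_left hC sdiff_disjoint
  have hCA : Disjoint C A := disjoint_of_subset_left (hC.trans sdiff_subset) sdiff_disjoint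
  have r0 : IsColoring k (fun _ : Sym2 V => 0) (fun _ => ∅) := ⟨by simp, by simp, by simp⟩
  have r1 := r0.update (a := x) (b := y) (A := A) hA (by simp) (by simp)
  have r2 := r1.update (a := y) (b := z) (A := B) (hB.trans sdiff_subset)
    (disjoint_update (by simp) fun _ => hBA) (disjoint_update (by simp) fun _ => hBA)
  have r3 := r2.update (a := x) (b := z) (A := C) (hC.trans (sdiff_subset.trans sdiff_subset))
    (disjoint_update (disjoint_update (by simp) fun _ => hCA) fun _ => hCB)
    (disjoint_update (disjoint_update (by simp) fun _ => hCA) fun _ => hCB)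
  refine ⟨_, r3.congr ?_⟩
  funext e
  simp only [Function.update_apply]
  split_ifs with g1 g2 g3
  · rw [g1, hCc]
  · rw [g2, hBc]
  · rw [g3, hAc]
  · exact (h e g3 g2 g1).symm

end WeightedGraph

/-! ### 2-trees and their reducible configurations. -/

/-- A decomposition of a 2-tree with two adjacent roots `s` and `t`: the tree `node v l r n` stands
for a common neighbour `v` of the roots, a 2-tree `l` with roots `s` and `v`, a 2-tree `r` with
roots `v` and `t`, and a 2-tree `n` with roots `s` and `t`. -/
inductive SPTree (V : Type*)
  | nil : SPTree V
  | node (v : V) (l r n : SPTree V) : SPTree V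

namespace SPTree

variable {V : Type*}

/-- The vertices other than the roots. -/
def verts : SPTree V → List V
  | nil => []
  | node v l r n => v :: (l.verts ++ (r.verts ++ n.verts))

/-- The edges of the 2-tree with the roots `s` and `t`. -/
def edges : SPTree V → V → V → Set (Sym2 V)
  | nil, s, t => {s(s, t)}
  | node v l r n, s, t => l.edges s v ∪ (r.edges v t ∪ n.edges s t)

theorem root_mem_edges (T : SPTree V) (s t : V) : s(s, t) ∈ T.edges s t := by
  induction T generalizing s t with
  | nil => exact rfl
  | node v l r n _ _ ihn => exact .inr (.inr (ihn s t))

theorem mem_of_mem_edges {T : SPTree V} {s t : V} {e : Sym2 V} (he : e ∈ T.edges s t) {x : V}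
    (hx : x ∈ e) : x = s ∨ x = t ∨ x ∈ T.verts := by
  induction T generalizing s t with
  | nil =>
    rw [edges, Set.mem_singleton_iff] at he
    subst he
    rcases Sym2.mem_iff.1 hx with h | h <;> simp [h]
  | node v l r n ihl ihr ihn =>
    simp only [verts, List.mem_cons, List.mem_append]
    rcases he with he | he | he
    · rcases ihl he with h | h | h <;> simp [h]
    · rcases ihr he with h | h | h <;> simp [h]
    · rcases ihn he with h | h | h <;> simp [h]

theorem notMem_of_mem_edges {T : SPTree V} {s t : V} {e : Sym2 V} (he : e ∈ T.edges s t) {x : V}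
    (hs : x ≠ s) (ht : x ≠ t) (hx : x ∉ T.verts) : x ∉ e := fun h => by
  rcases mem_of_mem_edges he h with h | h | h <;> contradiction

/-- Every vertex is on an edge. -/
theorem exists_mem_edges {T : SPTree V} {s t : V} {x : V} (hx : x = s ∨ x = t ∨ x ∈ T.verts) :
    ∃ y, s(x, y) ∈ T.edges s t := by
  induction T generalizing s t with
  | nil =>
    rcases hx with rfl | rfl | hx
    · exact ⟨t, rfl⟩
    · exact ⟨s, Sym2.eq_swap⟩
    · simp [verts] at hx
  | node v l r n ihl ihr ihn =>
    rcases hx with rfl | rfl | hx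
    · obtain ⟨y, hy⟩ := ihn (s := x) (t := t) (.inl rfl)
      exact ⟨y, .inr (.inr hy)⟩
    · obtain ⟨y, hy⟩ := ihn (s := s) (t := x) (.inr (.inl rfl))
      exact ⟨y, .inr (.inr hy)⟩
    · simp only [verts, List.mem_cons, List.mem_append] at hx
      rcases hx with rfl | hx | hx | hx
      · obtain ⟨y, hy⟩ := ihl (s := s) (t := x) (.inr (.inl rfl))
        exact ⟨y, .inl hy⟩
      · obtain ⟨y, hy⟩ := ihl (s := s) (t := v) (.inr (.inr hx))
        exact ⟨y, .inl hy⟩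
      · obtain ⟨y, hy⟩ := ihr (s := v) (t := t) (.inr (.inr hx))
        exact ⟨y, .inr (.inl hy)⟩
      · obtain ⟨y, hy⟩ := ihn (s := s) (t := t) (.inr (.inr hx))
        exact ⟨y, .inr (.inr hy)⟩

/-- A new vertex can be joined to the ends of an edge of a 2-tree. -/
theorem exists_insert (T : SPTree V) {s t a b : V} (v : V) (h : s(a, b) ∈ T.edges s t) :
    ∃ T' : SPTree V, T'.verts.Perm (v :: T.verts) ∧ T.edges s t ⊆ T'.edges s t ∧
      s(v, a) ∈ T'.edges s t ∧ s(v, b) ∈ T'.edges s t := by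
  induction T generalizing s t with
  | nil =>
    refine ⟨node v nil nil nil, List.Perm.refl _, fun e he => .inr (.inr he), ?_⟩
    rcases Sym2.eq_iff.1 (Set.mem_singleton_iff.1 h) with ⟨rfl, rfl⟩ | ⟨rfl, rfl⟩
    · exact ⟨.inl Sym2.eq_swap, .inr (.inl rfl)⟩
    · exact ⟨.inr (.inl rfl), .inl Sym2.eq_swap⟩
  | node u l r n ihl ihr ihn =>
    rcases h with h | h | h
    · obtain ⟨l', h1, h2, h3, h4⟩ := ihl h
      refine ⟨node u l' r n, ?_, Set.union_subset_union_left _ h2, .inl h3, .inl h4⟩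
      exact ((h1.append_right _).cons u).trans (List.Perm.swap _ _ _)
    · obtain ⟨r', h1, h2, h3, h4⟩ := ihr h
      refine ⟨node u l r' n, ?_, Set.union_subset_union_right _ (Set.union_subset_union_left _ h2),
        .inr (.inl h3), .inr (.inl h4)⟩
      refine List.Perm.trans ?_ (List.Perm.swap _ _ _)
      refine List.Perm.cons u ?_
      exact ((h1.append_right _).append_left _).trans List.perm_middle
    · obtain ⟨n', h1, h2, h3, h4⟩ := ihn h
      refine ⟨node u l r n', ?_, Set.union_subset_union_right _ (Set.union_subset_union_right _ h2),
        .inr (.inr h3), .inr (.inr h4)⟩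
      refine List.Perm.trans ?_ (List.Perm.swap _ _ _)
      refine List.Perm.cons u ?_
      refine (List.Perm.append_left _ ((h1.append_left _).trans List.perm_middle)).trans
        List.perm_middle

/-- The two reducible configurations of a graph with the edges `E`, with interior vertices in `J` or
equal to the isolated vertex `o`. The edges of the reduced graph are in `E'`. -/
inductive Redex (o : V) (J : Set V) (E E' : Set (Sym2 V)) : Prop
  | twins (v v' s t : V) (hv : v ∈ J) (hv' : v' ∈ J) (hvv : v ≠ v') (hvs : v ≠ s) (hvt : v ≠ t)
      (hvs' : v' ≠ s) (hvt' : v' ≠ t) (hst : s ≠ t) (nv : ∀ y, s(v, y) ∈ E → y = s ∨ y = t)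
      (nv' : ∀ y, s(v', y) ∈ E → y = s ∨ y = t) (h1 : s(v, s) ∈ E') (h2 : s(v, t) ∈ E')
      (h3 : s(s, t) ∈ E') (h : ∀ e ∈ E, v' ∉ e → e ∈ E')
  | fan (x v v' s t : V) (hx : x ∈ J) (hv : v ∈ J ∨ v = o) (hv' : v' ∈ J ∨ v' = o) (hxv : x ≠ v)
      (hxv' : x ≠ v') (hxs : x ≠ s) (hxt : x ≠ t) (hvv : v ≠ v') (hvs : v ≠ s) (hvt : v ≠ t)
      (hvs' : v' ≠ s) (hvt' : v' ≠ t) (hst : s ≠ t)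
      (nx : ∀ y, s(x, y) ∈ E → y = s ∨ y = t ∨ y = v ∨ y = v')
      (nv : ∀ y, s(v, y) ∈ E → y = x ∨ y = s) (nv' : ∀ y, s(v', y) ∈ E → y = x ∨ y = t)
      (h1 : s(x, s) ∈ E') (h2 : s(x, t) ∈ E') (h3 : s(s, t) ∈ E')
      (h : ∀ e ∈ E, v ∉ e → v' ∉ e → e ∈ E')

/-- A configuration in a subtree survives in the whole tree because the other edges avoid its
interior vertices. Its attachment vertices `s`, `t` are unrestricted. -/
theorem Redex.union {o : V} {J J' : Set V} {E E' F G G' : Set (Sym2 V)} (h : Redex o J E E')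
    (hJ : J ⊆ J') (hF : ∀ e ∈ F, ∀ j ∈ J, j ∉ e) (ho : ∀ e ∈ F, o ∉ e) (hG : G = E ∪ F)
    (hG' : G' = E' ∪ F) : Redex o J' G G' := by
  subst hG hG'
  have hF' : ∀ v y, (v ∈ J ∨ v = o) → s(v, y) ∈ E ∪ F → s(v, y) ∈ E := by
    rintro v y hv (h' | h')
    · exact h'
    · rcases hv with hv | rfl
      · exact absurd (Sym2.mem_mk_left v y) (hF _ h' v hv)
      · exact absurd (Sym2.mem_mk_left v y) (ho _ h')
  cases h with
  | twins v v' s t hv hv' hvv hvs hvt hvs' hvt' hst nv nv' h1 h2 h3 h =>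
    refine .twins v v' s t (hJ hv) (hJ hv') hvv hvs hvt hvs' hvt' hst
      (fun y hy => nv y (hF' v y (.inl hv) hy)) (fun y hy => nv' y (hF' v' y (.inl hv') hy))
      (.inl h1) (.inl h2) (.inl h3) ?_
    rintro e (he | he) he'
    exacts [.inl (h e he he'), .inr he]
  | fan x v v' s t hx hv hv' hxv hxv' hxs hxt hvv hvs hvt hvs' hvt' hst nx nv nv' h1 h2 h3 h =>
    refine .fan x v v' s t (hJ hx) (hv.imp_left (@hJ _)) (hv'.imp_left (@hJ _)) hxv hxv' hxs hxt hvv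
      hvs hvt hvs' hvt' hst (fun y hy => nx y (hF' x y (.inl hx) hy))
      (fun y hy => nv y (hF' v y hv hy)) (fun y hy => nv' y (hF' v' y hv' hy))
      (.inl h1) (.inl h2) (.inl h3) ?_
    rintro e (he | he) he' he''
    exacts [.inl (h e he he' he''), .inr he]

theorem eq_of_mem_edges_nil {s t x y : V} (h : s(x, y) ∈ (nil : SPTree V).edges s t) :
    x = s ∧ y = t ∨ x = t ∧ y = s := Sym2.eq_iff.1 (Set.mem_singleton_iff.1 h)

theorem ne_of_notMem_left {e : Sym2 V} {a : V} (h : a ∉ e) (b : V) : e ≠ s(a, b) := by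
  rintro rfl
  exact h (Sym2.mem_mk_left a b)

theorem ne_of_notMem_right {e : Sym2 V} {a : V} (h : a ∉ e) (b : V) : e ≠ s(b, a) := by
  rintro rfl
  exact h (Sym2.mem_mk_right b a)

/-- If no subtree of the root node is reducible, each of `l`, `r`, `n` has at most one vertex. With
`l` and `r` empty, `v` and the vertex of `n` (if any) are twins. Otherwise `v` is the centre of a
fan, in which the isolated vertex `o` stands in for a missing side vertex; this avoids a separate
reduction for half fans. -/
theorem exists_redex (o : V) (T : SPTree V) (s t : V) (hT : (o :: s :: t :: T.verts).Nodup) :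
    T = nil ∨ (∃ v, T = node v nil nil nil) ∨
      ∃ T' : SPTree V, T'.verts.Sublist T.verts ∧ T'.verts.length < T.verts.length ∧
        Redex o {x | x ∈ T.verts} (T.edges s t) (T'.edges s t) := by
  induction T generalizing s t with
  | nil => exact .inl rfl
  | node v l r n ihl ihr ihn =>
    right
    simp only [verts, List.nodup_cons, List.mem_cons, List.mem_append, not_or,
      List.nodup_append] at hT
    obtain ⟨⟨hos, hot, hov, hol, hor, hon⟩, ⟨hst, hsv, hsl, hsr, hsn⟩, ⟨htv, htl, htr, htn⟩,
      ⟨hvl, hvr, hvn⟩, hl, ⟨hr, hn, hrn⟩, hlrn⟩ := hT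
    have hlr : ∀ a ∈ l.verts, a ∉ r.verts := fun a h h' => hlrn a h a (.inl h') rfl
    have hln : ∀ a ∈ l.verts, a ∉ n.verts := fun a h h' => hlrn a h a (.inr h') rfl
    replace hrn : ∀ a ∈ r.verts, a ∉ n.verts := fun a h h' => hrn a h a h' rfl
    have ol : ∀ e ∈ l.edges s v, o ∉ e := fun e he => notMem_of_mem_edges he hos hov hol
    have or : ∀ e ∈ r.edges v t, o ∉ e := fun e he => notMem_of_mem_edges he hov hot hor
    have on : ∀ e ∈ n.edges s t, o ∉ e := fun e he => notMem_of_mem_edges he hos hot hon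
    have ne : ∀ {a b : V} {m : List V}, a ∉ m → b ∈ m → b ≠ a := fun h h' h'' => h (h'' ▸ h')
    -- From here on, exhibiting any reduction contradicts the negation of `H`.
    by_cases H : ∃ T' : SPTree V, T'.verts.Sublist (node v l r n).verts ∧
        T'.verts.length < (node v l r n).verts.length ∧ Redex o {x | x ∈ (node v l r n).verts}
          ((node v l r n).edges s t) (T'.edges s t)
    · exact .inr H
    have hl' : l = nil ∨ ∃ a, l = node a nil nil nil := by
      rcases ihl s v (by simp [hos, hov, hol, hsv, hsl, hvl, hl]) with h | h | ⟨l', h1, h2, h3⟩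
      · exact .inl h
      · exact .inr h
      refine absurd ⟨node v l' r n, (h1.append_right _).cons_cons v, by simp [verts, h2],
        h3.union (fun x hx => by simp_all [verts]) ?_ ?_ rfl rfl⟩ H
      · rintro e (he | he) j hj
        · exact notMem_of_mem_edges he (ne hvl hj) (ne htl hj) (hlr j hj)
        · exact notMem_of_mem_edges he (ne hsl hj) (ne htl hj) (hln j hj)
      · rintro e (he | he)
        exacts [or e he, on e he]
    have hr' : r = nil ∨ ∃ a, r = node a nil nil nil := by
      rcases ihr v t (by simp [hov, hot, hor, Ne.symm htv, hvr, htr, hr]) with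
        h | h | ⟨r', h1, h2, h3⟩
      · exact .inl h
      · exact .inr h
      refine absurd ⟨node v l r' n, ((h1.append_right _).append_left _).cons_cons v,
        by simp [verts, h2], h3.union (F := l.edges s v ∪ n.edges s t)
          (fun x hx => by simp_all [verts]) ?_ ?_ (Set.union_left_comm _ _ _)
          (Set.union_left_comm _ _ _)⟩ H
      · rintro e (he | he) j hj
        · exact notMem_of_mem_edges he (ne hsr hj) (ne hvr hj) fun h => hlr j h hj
        · exact notMem_of_mem_edges he (ne hsr hj) (ne htr hj) (hrn j hj)
      · rintro e (he | he)
        exacts [ol e he, on e he]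
    have hn' : n = nil ∨ ∃ a, n = node a nil nil nil := by
      rcases ihn s t (by simp [hos, hot, hon, hst, hsn, htn, hn]) with h | h | ⟨n', h1, h2, h3⟩
      · exact .inl h
      · exact .inr h
      have hun : ∀ X : Set (Sym2 V),
          l.edges s v ∪ (r.edges v t ∪ X) = X ∪ (l.edges s v ∪ r.edges v t) := fun X => by
        rw [← Set.union_assoc, Set.union_comm]
      refine absurd ⟨node v l r n', ((h1.append_left _).append_left _).cons_cons v,
        by simp [verts, h2], h3.union (F := l.edges s v ∪ r.edges v t)
          (fun x hx => by simp_all [verts]) ?_ ?_ (hun _) (hun _)⟩ H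
      · rintro e (he | he) j hj
        · exact notMem_of_mem_edges he (ne hsn hj) (ne hvn hj) fun h => hln j h hj
        · exact notMem_of_mem_edges he (ne hvn hj) (ne htn hj) fun h => hrn j h hj
      · rintro e (he | he)
        exacts [ol e he, or e he]
    clear ihl ihr ihn hlrn
    have hsv' : s(v, s) ∈ (nil : SPTree V).edges s v := Sym2.eq_swap
    have hvt' : s(v, t) ∈ (nil : SPTree V).edges v t := rfl
    rcases hl' with rfl | ⟨a, rfl⟩ <;> rcases hr' with rfl | ⟨b, rfl⟩
    · rcases hn' with rfl | ⟨c, rfl⟩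
      · exact .inl ⟨v, rfl⟩
      refine absurd ⟨node v nil nil nil, by simp [verts], by simp [verts],
        .twins v c s t (by simp [verts]) (by simp [verts]) ?_ ?_ ?_ ?_ ?_ hst ?_ ?_
          (.inl hsv') (.inr (.inl hvt')) (.inr (.inr rfl)) ?_⟩ H
      all_goals simp only [verts, List.mem_cons, List.append_nil, List.nil_append] at *
      · grind
      · grind
      · grind
      · grind
      · grind
      · intro y hy
        simp only [edges, Set.mem_union, Set.mem_singleton_iff, Sym2.eq_iff] at hy
        grind
      · intro y hy
        simp only [edges, Set.mem_union, Set.mem_singleton_iff, Sym2.eq_iff] at hy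
        grind
      · intro e he hc
        simp only [edges, Set.mem_union, Set.mem_singleton_iff] at he ⊢
        grind
    · have nn : ∀ x y, x ≠ s → x ≠ t → x ∉ n.verts → s(x, y) ∉ n.edges s t := fun x y h1 h2 h3 h =>
        notMem_of_mem_edges h h1 h2 h3 (Sym2.mem_mk_left x y)
      -- Only `v` with its edges to `s` and `t` remains of the fan, and `n` is untouched.
      refine absurd ⟨node v nil nil n, by simp [verts], by simp [verts],
        .fan v o b s t (by simp [verts]) (.inr rfl) (.inl (by simp [verts])) ?_ ?_ ?_ ?_ ?_ ?_ ?_ ?_ ?_ hst ?_ ?_ ?_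
          (.inl hsv') (.inr (.inl hvt')) (.inr (.inr (root_mem_edges n s t))) ?_⟩ H
      all_goals simp only [verts, List.mem_cons, List.append_nil, List.nil_append] at *
      iterate 9 grind
      iterate 3
        intro y hy
        simp only [edges, Set.mem_union, Set.mem_singleton_iff, Sym2.eq_iff] at hy
        grind
      intro e he h1 h2
      have k3 := ne_of_notMem_left h2
      have k4 := ne_of_notMem_right h2
      clear H
      simp only [edges, Set.mem_union, Set.mem_singleton_iff, k3, k4, false_or] at he ⊢
      tauto
    · have nn : ∀ x y, x ≠ s → x ≠ t → x ∉ n.verts → s(x, y) ∉ n.edges s t := fun x y h1 h2 h3 h =>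
        notMem_of_mem_edges h h1 h2 h3 (Sym2.mem_mk_left x y)
      refine absurd ⟨node v nil nil n, by simp [verts], by simp [verts],
        .fan v a o s t (by simp [verts]) (.inl (by simp [verts])) (.inr rfl) ?_ ?_ ?_ ?_ ?_ ?_ ?_ ?_ ?_ hst ?_ ?_ ?_
          (.inl hsv') (.inr (.inl hvt')) (.inr (.inr (root_mem_edges n s t))) ?_⟩ H
      all_goals simp only [verts, List.mem_cons, List.append_nil, List.nil_append] at *
      iterate 9 grind
      iterate 3
        intro y hy
        simp only [edges, Set.mem_union, Set.mem_singleton_iff, Sym2.eq_iff] at hy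
        grind
      intro e he h1 h2
      have k1 := ne_of_notMem_left h1
      have k2 := ne_of_notMem_right h1
      clear H
      simp only [edges, Set.mem_union, Set.mem_singleton_iff, k1, k2, false_or] at he ⊢
      tauto
    · have nn : ∀ x y, x ≠ s → x ≠ t → x ∉ n.verts → s(x, y) ∉ n.edges s t := fun x y h1 h2 h3 h =>
        notMem_of_mem_edges h h1 h2 h3 (Sym2.mem_mk_left x y)
      refine absurd ⟨node v nil nil n, by simp [verts], by simp [verts],
        .fan v a b s t (by simp [verts]) (.inl (by simp [verts])) (.inl (by simp [verts])) ?_ ?_ ?_ ?_ ?_ ?_ ?_ ?_ ?_ hst ?_ ?_ ?_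
          (.inl hsv') (.inr (.inl hvt')) (.inr (.inr (root_mem_edges n s t))) ?_⟩ H
      all_goals simp only [verts, List.mem_cons, List.append_nil] at *
      iterate 9 grind
      iterate 3
        intro y hy
        simp only [edges, Set.mem_union, Set.mem_singleton_iff, Sym2.eq_iff] at hy
        grind
      intro e he h1 h2
      have k1 := ne_of_notMem_left h1
      have k2 := ne_of_notMem_right h1
      have k3 := ne_of_notMem_left h2
      have k4 := ne_of_notMem_right h2
      clear H
      simp only [edges, Set.mem_union, Set.mem_singleton_iff, k1, k2, k3, k4, false_or] at he ⊢
      tauto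

end SPTree

/-! ### Colouring subgraphs of 2-trees by induction. -/

namespace WeightedGraph

theorem exists_coloring_of_tree {V : Type*} [DecidableEq V] [Fintype V] {k : ℕ} (o : V) (m : ℕ) :
    ∀ (T : SPTree V) (s t : V) (w : Sym2 V → ℕ), T.verts.length = m →
      (o :: s :: t :: T.verts).Nodup → (∀ e, w e ≠ 0 → e ∈ T.edges s t) → IsBounded k w →
      ∃ φ, IsColoring k w φ := by
  induction m using Nat.strong_induction_on with
  | _ m ih =>
    intro T s t w hm hT hsup hw
    have hz : ∀ e, e ∉ T.edges s t → w e = 0 := fun e he => by_contra fun h => he (hsup e h)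
    rcases T.exists_redex o s t hT with rfl | ⟨v, rfl⟩ | ⟨T', h1, h2, h3⟩
    -- A single bundle `st` is treated as a triangle with third vertex `o`.
    · simp only [SPTree.verts, List.nodup_cons, List.mem_cons, not_or] at hT
      exact exists_coloring_of_triangle hw (x := o) (y := s) (z := t) hT.1.1 hT.1.2.1 hT.2.1.1
        fun e _ h _ => hz e h
    · simp only [SPTree.verts, List.nodup_cons, List.mem_cons, not_or, List.append_nil] at hT
      refine exists_coloring_of_triangle hw (x := s) (y := v) (z := t) hT.2.1.2.1 hT.2.1.1
        (Ne.symm hT.2.2.1.1) fun e h1 h2 h3 => hz e ?_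
      rintro (h | h | h)
      exacts [h1 h, h2 h, h3 h]
    · have hT' : (o :: s :: t :: T'.verts).Nodup :=
        hT.sublist (((h1.cons_cons t).cons_cons s).cons_cons o)
      -- The gadget only adds multiplicity on the three pairs among `y`, `u`, `u'`, which are edges
      -- of the smaller tree.
      have key : ∀ (I : Finset V) (y u u' : V) (L p q : ℕ), s(y, u) ∈ T'.edges s t →
          s(y, u') ∈ T'.edges s t → s(u, u') ∈ T'.edges s t →
          (∀ e ∈ T.edges s t, (∀ i ∈ I, i ∉ e) → e ∈ T'.edges s t) →
          IsBounded k (gadget w I y u u' L p q) →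
          ∃ φ, IsColoring k (gadget w I y u u' L p q) φ := by
        intro I y u u' L p q g1 g2 g3 hE hb
        refine ih _ (hm ▸ h2) T' s t _ rfl hT' (fun e he => ?_) hb
        unfold gadget del at he
        split_ifs at he with c1 c2 c3 c4 c5 c6 c7 c8 c9 <;> first
          | exact c2 ▸ g3
          | (subst e; assumption)
          | exact absurd rfl he
          | exact hE e (hsup e he) fun i hi hie => c1 ⟨i, hi, hie⟩
      cases h3 with
      | twins v v' a b hv hv' hvv hvs hvt hvs' hvt' hst nv nv' h1 h2 h3 h =>
        refine exists_coloring_of_twins hw hvv hvs hvt hvs' hvt' hst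
          (fun y g1 g2 => hz _ fun g => ?_) (fun y g1 g2 => hz _ fun g => ?_)
          fun L p q => key _ v a b L p q h1 h2 h3 fun e he hi => h e he (hi v' (by simp))
        · rcases nv y g with g | g <;> contradiction
        · rcases nv' y g with g | g <;> contradiction
      | fan x v v' a b hx hv hv' hxv hxv' hxs hxt hvv hvs hvt hvs' hvt' hst nx nv nv' h1 h2 h3 h =>
        refine exists_coloring_of_fan hw hxv hxv' hxs hxt hvv hvs hvt hvs' hvt' hst
          (fun y g1 g2 g3 g4 => hz _ fun g => ?_) (fun y g1 g2 => hz _ fun g => ?_)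
          (fun y g1 g2 => hz _ fun g => ?_)
          fun L p q => key _ x a b L p q h1 h2 h3 fun e he hi => h e he (hi v (by simp))
            (hi v' (by simp))
        · rcases nx y g with g | g | g | g <;> contradiction
        · rcases nv y g with g | g <;> contradiction
        · rcases nv' y g with g | g <;> contradiction

end WeightedGraph

/-! ### Graphs without a `K₄` subdivision lie in 2-trees. -/

namespace SimpleGraph

variable {V : Type*} {H : SimpleGraph V}

/-- To find a subdivision of `K₄` it suffices to connect the branch vertices inside sets that
overlap in common ends only. -/
theorem hasK4Subdivision_of_sets (f : Fin 4 → V) (hf : Function.Injective f)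
    (P : Fin 4 → Fin 4 → Set V)
    (hp : ∀ i j, i < j → ∃ p : H.Walk (f i) (f j), ∀ v ∈ p.support, v ∈ P i j)
    (hP : ∀ i j k l, i < j → k < l → (i, j) ≠ (k, l) → ∀ v, v ∈ P i j → v ∈ P k l →
      (v = f i ∨ v = f j) ∧ (v = f k ∨ v = f l)) : H.HasK4Subdivision := by
  classical
  choose q hq using hp
  -- Only the walks with `i < j` matter; the others are fillers.
  refine ⟨f, fun i j => if h : i < j then (q i j h).bypass else if h' : j < i then
    (q j i h').bypass.reverse else (Walk.nil' (f i)).copy rfl (by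
      rw [le_antisymm (not_lt.1 h') (not_lt.1 h)]), hf, ?_, ?_⟩
  · intro i j h
    simp only [h, dif_pos]
    exact Walk.bypass_isPath _
  · intro i j k l hij hkl hne v hv hv'
    simp only [hij, hkl, dif_pos] at hv hv'
    exact hP i j k l hij hkl hne v (hq _ _ _ _ (Walk.support_bypass_subset_support _ hv))
      (hq _ _ _ _ (Walk.support_bypass_subset_support _ hv'))

/-- The first `N + 1` values of `g` are the vertices of a path. -/
structure IsPathSeq (H : SimpleGraph V) (N : ℕ) (g : ℕ → V) : Prop where
  adj : ∀ n < N, H.Adj (g n) (g (n + 1))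
  inj : ∀ m ≤ N, ∀ n ≤ N, g m = g n → m = n

theorem IsPathSeq.exists_walk {N : ℕ} {g : ℕ → V} (h : IsPathSeq H N g) {a b : ℕ} (hab : a ≤ b)
    (hb : b ≤ N) : ∃ p : H.Walk (g a) (g b), ∀ v ∈ p.support, ∃ n, a ≤ n ∧ n ≤ b ∧ v = g n := by
  induction b, hab using Nat.le_induction with
  | base => exact ⟨Walk.nil, fun v hv => ⟨a, le_rfl, le_rfl, by simpa using hv⟩⟩
  | succ b hab ih =>
    obtain ⟨p, hp⟩ := ih (by omega)
    refine ⟨p.concat (h.adj b (by omega)), fun v hv => ?_⟩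
    rw [Walk.support_concat, List.mem_append, List.mem_singleton] at hv
    rcases hv with hv | rfl
    · obtain ⟨n, h1, h2, h3⟩ := hp v hv
      exact ⟨n, h1, by omega, h3⟩
    · exact ⟨b + 1, by omega, le_rfl, rfl⟩

/-- The branch vertices sit at positions `0`, `i - 1`, `i`, `j`. Three connections are single edges,
and two are segments of the path; the one from `i - 1` to `j` takes the chord to `l` and returns
along the path. `S a b` is the set of positions visited. -/
theorem IsPathSeq.hasK4Subdivision {N : ℕ} {g : ℕ → V} (h : IsPathSeq H N g) {i j l : ℕ}
    (hi : 2 ≤ i) (hij : i < j) (hjl : j ≤ l) (hl : l ≤ N) (h1 : H.Adj (g 0) (g i))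
    (h2 : H.Adj (g 0) (g j)) (h3 : H.Adj (g (i - 1)) (g l)) : H.HasK4Subdivision := by
  let r : Fin 4 → ℕ := ![0, i - 1, i, j]
  let S : Fin 4 → Fin 4 → ℕ → Prop := fun a b n =>
    if a = 0 then if b = 1 then n ≤ i - 1 else if b = 2 then n = 0 ∨ n = i else n = 0 ∨ n = j
    else if a = 1 then if b = 2 then n = i - 1 ∨ n = i else n = i - 1 ∨ (j ≤ n ∧ n ≤ l)
    else i ≤ n ∧ n ≤ j
  have edge : ∀ {a b : ℕ}, H.Adj (g a) (g b) → ∃ p : H.Walk (g a) (g b), ∀ v ∈ p.support,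
      ∃ n, (n = a ∨ n = b) ∧ v = g n := by
    intro a b hab
    refine ⟨hab.toWalk, fun v hv => ?_⟩
    simp only [Adj.toWalk, Walk.support_cons, Walk.support_nil, List.mem_cons,
      List.not_mem_nil, or_false] at hv
    rcases hv with rfl | rfl
    exacts [⟨a, .inl rfl, rfl⟩, ⟨b, .inr rfl, rfl⟩]
  have hr : ∀ a, r a ≤ N := by intro a; fin_cases a <;> simp [r] <;> omega
  have hrinj : ∀ a b, r a = r b → a = b := by
    intro a b
    fin_cases a <;> fin_cases b <;> simp [r] <;> omega
  refine hasK4Subdivision_of_sets (fun a => g (r a)) (fun a b hab => hrinj a b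
    (h.inj _ (hr a) _ (hr b) hab)) (fun a b => {v | ∃ n ≤ N, S a b n ∧ v = g n}) ?_ ?_
  · intro a b hab
    suffices ∃ p : H.Walk (g (r a)) (g (r b)), ∀ v ∈ p.support, ∃ n, S a b n ∧ v = g n by
      obtain ⟨p, hp⟩ := this
      refine ⟨p, fun v hv => ?_⟩
      obtain ⟨n, hn, hv⟩ := hp v hv
      refine ⟨n, ?_, hn, hv⟩
      clear hp
      fin_cases a <;> fin_cases b <;> simp [S] at hn hab <;> omega
    fin_cases a <;> fin_cases b <;> first | exact absurd hab (by decide) | skip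
    · obtain ⟨p, hp⟩ := h.exists_walk (Nat.zero_le (i - 1)) (by omega)
      exact ⟨p, fun v hv => by obtain ⟨n, _, h, h'⟩ := hp v hv; exact ⟨n, h, h'⟩⟩
    · exact edge h1
    · exact edge h2
    · have := h.adj (i - 1) (by omega)
      rw [Nat.sub_add_cancel (by omega)] at this
      exact edge this
    · obtain ⟨p, hp⟩ := h.exists_walk hjl hl
      obtain ⟨q, hq⟩ : ∃ q : H.Walk (g (i - 1)) (g j), ∀ v ∈ q.support,
        v = g (i - 1) ∨ v ∈ p.support := ⟨.cons h3 p.reverse, by simp⟩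
      refine ⟨q, fun v hv => ?_⟩
      rcases hq v hv with rfl | hv
      · exact ⟨i - 1, .inl rfl, rfl⟩
      · obtain ⟨n, h1, h2, h3⟩ := hp v hv
        exact ⟨n, .inr ⟨h1, h2⟩, h3⟩
    · obtain ⟨p, hp⟩ := h.exists_walk hij.le (by omega)
      exact ⟨p, fun v hv => by obtain ⟨n, h, h', h''⟩ := hp v hv; exact ⟨n, ⟨h, h'⟩, h''⟩⟩
  · rintro a b c d hab hcd hne v ⟨n, hn, hS, rfl⟩ ⟨m, hm, hS', hv⟩
    obtain rfl := h.inj _ hn _ hm hv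
    suffices (n = r a ∨ n = r b) ∧ (n = r c ∨ n = r d) from
      ⟨this.1.imp (congrArg g) (congrArg g), this.2.imp (congrArg g) (congrArg g)⟩
    fin_cases a <;> fin_cases b <;> simp at hab <;> fin_cases c <;> fin_cases d <;>
      simp at hcd hne <;> simp [S, r] at hS hS' ⊢ <;> omega

theorem IsPathSeq.cons {N : ℕ} {g : ℕ → V} (h : IsPathSeq H N g) {x : V} (hx : H.Adj (g 0) x)
    (hne : ∀ n ≤ N, g n ≠ x) : IsPathSeq H (N + 1) (fun n => if n = 0 then x else g (n - 1)) := by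
  constructor
  · intro n hn
    rcases Nat.eq_zero_or_pos n with rfl | h0
    · simpa using hx.symm
    · have := h.adj (n - 1) (by omega)
      rw [Nat.sub_add_cancel h0] at this
      simpa [h0.ne'] using this
  · intro m hm n hn hmn
    by_cases hm0 : m = 0 <;> by_cases hn0 : n = 0 <;> simp only [hm0, hn0, if_true, if_false] at hmn
    · omega
    · exact absurd hmn.symm (hne _ (by omega))
    · exact absurd hmn (hne _ (by omega))
    · have := h.inj _ (by omega) _ (by omega) hmn
      omega

/-- Reversing the initial segment before `i` uses the chord from `0` to `i` in place of the edge
from `i - 1` to `i`. The new path has the same vertices and starts at the old `g (i - 1)`. -/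
theorem IsPathSeq.rotate {N : ℕ} {g : ℕ → V} (h : IsPathSeq H N g) {i : ℕ} (hiN : i ≤ N)
    (hadj : H.Adj (g 0) (g i)) :
    IsPathSeq H N (fun n => if n < i then g (i - 1 - n) else g n) := by
  constructor
  · intro n hn
    rcases lt_trichotomy (n + 1) i with h1 | h1 | h1
    · have := h.adj (i - 1 - (n + 1)) (by omega)
      rw [show i - 1 - (n + 1) + 1 = i - 1 - n by omega] at this
      simpa [h1, show n < i by omega] using this.symm
    · simpa [h1, show n < i by omega, show i - 1 - n = 0 by omega] using hadj
    · simpa [show ¬ n < i by omega, show ¬ n + 1 < i by omega] using h.adj n hn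
  · intro m hm n hn hmn
    split_ifs at hmn
    all_goals
      have := h.inj _ (by omega) _ (by omega) hmn
      omega

/-- A finite graph with an edge in which every degree is zero or at least three has a subdivision
of `K₄`. -/
theorem hasK4Subdivision_of_degrees [Fintype V] {a b : V} (hab : H.Adj a b)
    (hdeg : ∀ u v, H.Adj u v → ∀ x y : V, ∃ z, H.Adj u z ∧ z ≠ x ∧ z ≠ y) :
    H.HasK4Subdivision := by
  classical
  have hne : ∃ N, 1 ≤ N ∧ ∃ g, IsPathSeq H N g := by
    refine ⟨1, le_rfl, fun n => if n = 0 then a else b, ?_, ?_⟩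
    · intro n hn
      obtain rfl : n = 0 := by omega
      simpa
    · intro m hm n hn h
      have := hab.ne
      interval_cases m <;> interval_cases n <;> simp_all
  have hbd : ∀ N, (1 ≤ N ∧ ∃ g, IsPathSeq H N g) → N ≤ Fintype.card V := by
    rintro N ⟨-, g, hg⟩
    have : Function.Injective (fun n : Fin (N + 1) => g n) := fun m n h =>
      Fin.ext (hg.inj _ (by omega) _ (by omega) h)
    have := Fintype.card_le_of_injective _ this
    rw [Fintype.card_fin] at this
    omega
  -- `N` is the length of a longest path.
  obtain ⟨N, hN, hmax⟩ : ∃ N, (1 ≤ N ∧ ∃ g, IsPathSeq H N g) ∧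
      ∀ M, (1 ≤ M ∧ ∃ g, IsPathSeq H M g) → M ≤ N :=
    ⟨_, Nat.findGreatest_spec (P := fun N => 1 ≤ N ∧ ∃ g, IsPathSeq H N g) (hbd _ hne.choose_spec)
      hne.choose_spec, fun M hM => Nat.le_findGreatest (hbd M hM) hM⟩
  obtain ⟨hN1, g₀, hg₀⟩ := hN
  -- all neighbours of the first vertex are on the path
  have hon : ∀ g, IsPathSeq H N g → ∀ x, H.Adj (g 0) x → ∃ n, 1 ≤ n ∧ n ≤ N ∧ g n = x := by
    intro g hg x hx
    by_contra hcon
    push Not at hcon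
    have := hmax (N + 1) ⟨by omega, _, hg.cons hx fun n hn => by
      rcases Nat.eq_zero_or_pos n with rfl | h0
      · exact hx.ne
      · exact hcon n h0 hn⟩
    omega
  -- there are two chords
  have hch : ∀ g, IsPathSeq H N g → ∃ i j, 2 ≤ i ∧ i < j ∧ j ≤ N ∧ H.Adj (g 0) (g i) ∧
      H.Adj (g 0) (g j) := by
    intro g hg
    have h01 := hg.adj 0 (by omega)
    obtain ⟨x, hx, hx1, -⟩ := hdeg _ _ h01 (g 1) (g 1)
    obtain ⟨y, hy, hy1, hyx⟩ := hdeg _ _ h01 (g 1) x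
    obtain ⟨m, hm1, hmN, rfl⟩ := hon g hg x hx
    obtain ⟨n, hn1, hnN, rfl⟩ := hon g hg y hy
    have hm : m ≠ 1 := by rintro rfl; exact hx1 rfl
    have hn : n ≠ 1 := by rintro rfl; exact hy1 rfl
    have hmn : m ≠ n := by rintro rfl; exact hyx rfl
    rcases lt_or_gt_of_ne hmn with h | h
    · exact ⟨m, n, by omega, h, hnN, hx, hy⟩
    · exact ⟨n, m, by omega, h, hmN, hy, hx⟩
  -- The shortest chord from a first vertex is taken over all longest paths, so that on each of them
  -- the second chord ends beyond `i`.
  have hex : ∃ i, 2 ≤ i ∧ i ≤ N ∧ ∃ g, IsPathSeq H N g ∧ H.Adj (g 0) (g i) := by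
    obtain ⟨i, j, h1, h2, h3, h4, -⟩ := hch g₀ hg₀
    exact ⟨i, h1, by omega, g₀, hg₀, h4⟩
  obtain ⟨hi, hiN, g, hg, hgi⟩ := Nat.find_spec hex
  have hmin : ∀ m, (2 ≤ m ∧ m ≤ N ∧ ∃ g, IsPathSeq H N g ∧ H.Adj (g 0) (g m)) →
      Nat.find hex ≤ m := fun m hm => Nat.find_min' hex hm
  generalize Nat.find hex = i at hi hiN hgi hmin
  have hlater : ∀ g, IsPathSeq H N g → ∃ j, i < j ∧ j ≤ N ∧ H.Adj (g 0) (g j) := by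
    intro g hg
    obtain ⟨m, n, h1, h2, h3, h4, h5⟩ := hch g hg
    have := hmin m ⟨h1, by omega, g, hg, h4⟩
    exact ⟨n, by omega, h3, h5⟩
  have hg' := hg.rotate hiN hgi
  obtain ⟨j, hij, hjN, hj⟩ := hlater g hg
  obtain ⟨l, hil, hlN, hl⟩ := hlater _ hg'
  simp only [show 0 < i by omega, if_true, show ¬ l < i by omega, if_false, Nat.sub_zero] at hl
  -- The path and its rotation play symmetric roles: rotating exchanges `j` and `l`.
  rcases le_total j l with h | h
  · exact hg.hasK4Subdivision hi hij h hlN hgi hj hl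
  · refine hg'.hasK4Subdivision hi hil h hjN ?_ ?_ ?_
    · have := hg.adj (i - 1) (by omega)
      rw [Nat.sub_add_cancel (by omega)] at this
      simpa [show 0 < i by omega] using this
    · simpa [show 0 < i by omega, show ¬ l < i by omega] using hl
    · simpa [show i - 1 < i by omega, show ¬ j < i by omega] using hj

/-- Delete the vertex `v` and join its neighbours. -/
def eliminate (H : SimpleGraph V) (v : V) : SimpleGraph V where
  Adj x y := x ≠ v ∧ y ≠ v ∧ (H.Adj x y ∨ H.Adj v x ∧ H.Adj v y ∧ x ≠ y)
  symm := ⟨fun _ _ h => ⟨h.2.1, h.1, h.2.2.imp (·.symm) fun h => ⟨h.2.1, h.1, h.2.2.symm⟩⟩⟩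
  loopless := ⟨fun _ h => h.2.2.elim (H.irrefl) fun h => h.2.2 rfl⟩

/-- An edge created by the elimination joins `a` and `b`, and is replaced by a detour through `v`.
Hence `v` appears only on walks that contain both `a` and `b`. -/
theorem exists_walk_of_eliminate {v a b : V} (hv : ∀ y, H.Adj v y → y = a ∨ y = b) {Z : Set V}
    {x y : V} (p : (H.eliminate v).Walk x y) (hp : ∀ z ∈ p.support, z ∈ Z) :
    ∃ q : H.Walk x y, ∀ z ∈ q.support, z ∈ Z ∨ (z = v ∧ a ∈ Z ∧ b ∈ Z ∧ a ≠ b) := by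
  induction p with
  | nil => exact ⟨Walk.nil, fun z hz => .inl (hp z (by simpa using hz))⟩
  | @cons x y u h p ih =>
    simp only [Walk.support_cons, List.mem_cons, forall_eq_or_imp] at hp
    obtain ⟨q, hq⟩ := ih hp.2
    have hy : y ∈ Z := hp.2 y p.start_mem_support
    rcases h.2.2 with hxy | ⟨hx, hy', hne⟩
    · refine ⟨.cons hxy q, ?_⟩
      simp only [Walk.support_cons, List.mem_cons, forall_eq_or_imp]
      exact ⟨.inl hp.1, hq⟩
    · refine ⟨.cons hx.symm (.cons hy' q), ?_⟩
      simp only [Walk.support_cons, List.mem_cons, forall_eq_or_imp]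
      refine ⟨.inl hp.1, .inr ⟨trivial, ?_⟩, hq⟩
      rcases hv _ hx with rfl | rfl <;> rcases hv _ hy' with rfl | rfl
      · exact absurd rfl hne
      · exact ⟨hp.1, hy, hne⟩
      · exact ⟨hy, hp.1, hne.symm⟩
      · exact absurd rfl hne

theorem notMem_support_of_eliminate {v x y : V} (p : (H.eliminate v).Walk x y) (hx : x ≠ v) :
    v ∉ p.support := by
  induction p with
  | nil => simpa using hx.symm
  | cons h p ih =>
    simp only [Walk.support_cons, List.mem_cons, not_or]
    exact ⟨hx.symm, ih h.2.1⟩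

theorem ne_of_eliminate_walk {v x y : V} (p : (H.eliminate v).Walk x y) (hxy : x ≠ y) : x ≠ v := by
  cases p with
  | nil => exact absurd rfl hxy
  | cons h p => exact h.1

/-- Lifting a subdivision of `K₄` could only fail if two of its paths were both rerouted through
`v`. Both would contain the distinct vertices `a` and `b`, which would then be the ends of both, so
the paths would join the same pair. -/
theorem IsSeriesParallel.eliminate {v a b : V} (hv : ∀ y, H.Adj v y → y = a ∨ y = b)
    (hH : H.IsSeriesParallel) : (H.eliminate v).IsSeriesParallel := by
  rintro ⟨f, p, hf, -, hp⟩
  refine hH (hasK4Subdivision_of_sets f hf (fun i j => {z | z ∈ (p i j).support ∨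
    (z = v ∧ a ∈ (p i j).support ∧ b ∈ (p i j).support ∧ a ≠ b)}) ?_ ?_)
  · intro i j _
    exact exists_walk_of_eliminate (Z := {z | z ∈ (p i j).support}) hv (p i j) fun z hz => hz
  · have hnv : ∀ i j, i < j → v ∉ (p i j).support := fun i j hij =>
      notMem_support_of_eliminate _ (ne_of_eliminate_walk (p i j) fun h => hij.ne (hf h))
    rintro i j k l hij hkl hne z (hz | ⟨rfl, ha, hb, hab⟩) (hz' | ⟨hz', ha', hb', hab⟩)
    · exact hp i j k l hij hkl hne z hz hz'
    · exact absurd (hz' ▸ hz) (hnv i j hij)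
    · exact absurd hz' (hnv k l hkl)
    · exfalso
      have h1 := hp i j k l hij hkl hne a ha ha'
      have h2 := hp i j k l hij hkl hne b hb hb'
      have key : ∀ m n : Fin 4, (a = f m ∨ a = f n) → (b = f m ∨ b = f n) →
          (a = f m ∧ b = f n) ∨ (a = f n ∧ b = f m) := by
        rintro m n (h | h) (h' | h')
        · exact absurd (h.trans h'.symm) hab
        · exact .inl ⟨h, h'⟩
        · exact .inr ⟨h, h'⟩
        · exact absurd (h.trans h'.symm) hab
      have hinj : ∀ {c : V} {m n : Fin 4}, c = f m → c = f n → m = n := fun h h' =>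
        hf (h.symm.trans h')
      rcases key i j h1.1 h2.1 with ⟨g1, g2⟩ | ⟨g1, g2⟩ <;>
        rcases key k l h1.2 h2.2 with ⟨g3, g4⟩ | ⟨g3, g4⟩
      · exact hne (Prod.ext (hinj g1 g3) (hinj g2 g4))
      · have := hinj g1 g3
        have := hinj g2 g4
        omega
      · have := hinj g1 g3
        have := hinj g2 g4
        omega
      · exact hne (Prod.ext (hinj g2 g4) (hinj g1 g3))

/-- A series-parallel graph is contained in a 2-tree. -/
theorem IsSeriesParallel.exists_tree [Fintype V] [DecidableEq V] (n : ℕ) :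
    ∀ (S : Finset V) (H : SimpleGraph V), S.card = n + 2 → (∀ x y, H.Adj x y → x ∈ S) →
      H.IsSeriesParallel → ∃ (s t : V) (T : SPTree V), (s :: t :: T.verts).Nodup ∧
        (∀ x, x ∈ s :: t :: T.verts ↔ x ∈ S) ∧ ∀ x y, H.Adj x y → s(x, y) ∈ T.edges s t := by
  induction n with
  | zero =>
    intro S H hS hH _
    obtain ⟨s, t, hst, rfl⟩ := Finset.card_eq_two.1 hS
    refine ⟨s, t, .nil, by simpa [SPTree.verts] using hst, by simp [SPTree.verts], fun x y h => ?_⟩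
    have h1 := hH x y h
    have h2 := hH y x h.symm
    have h3 := h.ne
    simp only [Finset.mem_insert, Finset.mem_singleton] at h1 h2
    rcases h1 with rfl | rfl <;> rcases h2 with rfl | rfl
    · exact absurd rfl h3
    · exact rfl
    · exact Sym2.eq_swap
    · exact absurd rfl h3
  | succ n ih =>
    intro S H hS hH hsp
    obtain ⟨v, hvS, a, b, hv⟩ : ∃ v ∈ S, ∃ a b, ∀ y, H.Adj v y → y = a ∨ y = b := by
      by_cases hE : ∃ x y, H.Adj x y
      · obtain ⟨x, y, hxy⟩ := hE
        by_contra hcon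
        push Not at hcon
        exact hsp (hasK4Subdivision_of_degrees hxy fun u v huv => hcon u (hH u v huv))
      · push Not at hE
        obtain ⟨v, hv⟩ : S.Nonempty := Finset.card_pos.1 (by omega)
        exact ⟨v, hv, v, v, fun y h => absurd h (hE v y)⟩
    have hc : (S.erase v).card = n + 2 := by rw [Finset.card_erase_of_mem hvS]; omega
    obtain ⟨s, t, T, hT, hTS, hTe⟩ := ih (S.erase v) (H.eliminate v) hc (by
      rintro x y ⟨hx, hy, h | h⟩
      · exact Finset.mem_erase.2 ⟨hx, hH x y h⟩
      · exact Finset.mem_erase.2 ⟨hx, hH x v h.1.symm⟩) (hsp.eliminate hv)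
    have hST : ∀ c ∈ S, c ≠ v → ∃ y, s(c, y) ∈ T.edges s t := fun c hc hcv =>
      SPTree.exists_mem_edges (by simpa using (hTS c).2 (Finset.mem_erase.2 ⟨hcv, hc⟩))
    -- The vertex `v` is to be attached to a tree edge containing all its neighbours. Two neighbours
    -- are adjacent after elimination; for fewer, any tree edge at the neighbour, or any edge at
    -- all, will do.
    obtain ⟨c, d, hcd, hvcd⟩ : ∃ c d, s(c, d) ∈ T.edges s t ∧ ∀ y, H.Adj v y → y = c ∨ y = d := by
      by_cases ha : H.Adj v a
      · by_cases hb : H.Adj v b ∧ a ≠ b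
        · exact ⟨a, b, hTe a b ⟨ha.ne', hb.1.ne', .inr ⟨ha, hb.1, hb.2⟩⟩, hv⟩
        · obtain ⟨d, hd⟩ := hST a (hH a v ha.symm) ha.ne'
          refine ⟨a, d, hd, fun y hy => .inl ?_⟩
          rcases hv y hy with rfl | rfl
          · rfl
          · by_contra hne
            exact hb ⟨hy, Ne.symm hne⟩
      · by_cases hb : H.Adj v b
        · obtain ⟨d, hd⟩ := hST b (hH b v hb.symm) hb.ne'
          refine ⟨b, d, hd, fun y hy => .inl ?_⟩
          rcases hv y hy with rfl | rfl
          · exact absurd hy ha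
          · rfl
        · refine ⟨s, t, T.root_mem_edges s t, fun y hy => ?_⟩
          rcases hv y hy with rfl | rfl <;> contradiction
    obtain ⟨T', hp, hsub, h1, h2⟩ := T.exists_insert v hcd
    have hp' : (s :: t :: T'.verts).Perm (v :: s :: t :: T.verts) := by
      refine ((hp.cons t).cons s).trans ?_
      refine ((List.Perm.swap v t _).cons s).trans (List.Perm.swap v s _)
    refine ⟨s, t, T', hp'.nodup_iff.2 (List.nodup_cons.2 ⟨fun h => ?_, hT⟩), fun x => ?_,
      fun x y hxy => ?_⟩
    · exact Finset.notMem_erase v S ((hTS v).1 h)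
    · rw [hp'.mem_iff, List.mem_cons, hTS, Finset.mem_erase]
      by_cases hx : x = v
      · simp [hx, hvS]
      · simp [hx]
    · by_cases hx : x = v
      · subst hx
        rcases hvcd y hxy with rfl | rfl
        exacts [h1, h2]
      · by_cases hy : y = v
        · subst hy
          rw [Sym2.eq_swap]
          rcases hvcd x hxy.symm with rfl | rfl
          exacts [h1, h2]
        · exact hsub (hTe x y ⟨hx, hy, .inl hxy⟩)

end SimpleGraph

/-! ### Seymour's theorem for series-parallel multigraphs. -/

namespace SPTree

variable {V W : Type*}

/-- Rename the vertices. -/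
def map (f : V → W) : SPTree V → SPTree W
  | nil => nil
  | node v l r n => node (f v) (l.map f) (r.map f) (n.map f)

theorem verts_map (f : V → W) (T : SPTree V) : (T.map f).verts = T.verts.map f := by
  induction T with
  | nil => rfl
  | node v l r n ihl ihr ihn => simp [map, verts, ihl, ihr, ihn]

theorem map_mem_edges (f : V → W) {T : SPTree V} {s t x y : V} (h : s(x, y) ∈ T.edges s t) :
    s(f x, f y) ∈ (T.map f).edges (f s) (f t) := by
  induction T generalizing s t with
  | nil =>
    rcases eq_of_mem_edges_nil h with ⟨rfl, rfl⟩ | ⟨rfl, rfl⟩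
    exacts [rfl, Sym2.eq_swap]
  | node v l r n ihl ihr ihn =>
    rcases h with h | h | h
    exacts [.inl (ihl h), .inr (.inl (ihr h)), .inr (.inr (ihn h))]

end SPTree

namespace WeightedGraph

open Finset

/-- Add an isolated vertex. -/
def addVertex {V : Type*} (w : Sym2 V → ℕ) : Sym2 (Option V) → ℕ :=
  Sym2.lift ⟨fun x y => x.elim 0 fun x => y.elim 0 fun y => w s(x, y), fun x y => by
    cases x <;> cases y <;> simp [Sym2.eq_swap]⟩

theorem IsBounded.addVertex {V : Type*} [Fintype V] {k : ℕ} {w : Sym2 V → ℕ}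
    (hw : IsBounded k w) : IsBounded k (addVertex w) := by
  classical
  have hnone : ∀ u, WeightedGraph.addVertex w s(none, u) = 0 := fun u => rfl
  have hnone' : ∀ u, WeightedGraph.addVertex w s(u, none) = 0 := fun u => by
    rw [Sym2.eq_swap]; exact hnone u
  have hsome : ∀ u v, WeightedGraph.addVertex w s(some u, some v) = w s(u, v) := fun u v => rfl
  have hdeg : ∀ v, ∑ u, WeightedGraph.addVertex w s(v, u) ≤ k := by
    rintro (_ | v)
    · simp [hnone]
    · simpa [Fintype.sum_option, hnone', hsome] using hw.deg v
  refine ⟨?_, hdeg, fun X hX => ?_⟩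
  · rintro (_ | v)
    exacts [rfl, hw.diag v]
  · by_cases h : none ∈ X
    · exact degSumOn_le_of_isolated hdeg h hnone
    · obtain ⟨Y, rfl⟩ : ∃ Y : Finset V, X = Y.map Function.Embedding.some :=
        ⟨X.eraseNone, by rw [map_some_eraseNone, erase_eq_of_notMem h]⟩
      rw [card_map] at hX ⊢
      simpa [degSumOn, hsome] using hw.odd Y hX

/-- Seymour's theorem: a series-parallel multigraph has an edge colouring with `k` colours if no
vertex has degree more than `k` and no odd set `X` of vertices spans more than `k(|X| - 1)/2`
edges. -/
theorem exists_coloring {V : Type*} [Fintype V] {k : ℕ} {w : Sym2 V → ℕ} {H : SimpleGraph V}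
    (hH : H.IsSeriesParallel) (hsup : ∀ x y, w s(x, y) ≠ 0 → H.Adj x y) (hw : IsBounded k w) :
    ∃ φ, IsColoring k w φ := by
  classical
  by_cases hV : Fintype.card V < 2
  -- A 2-tree has two roots, so graphs with fewer than two vertices are treated apart.
  · have : Subsingleton V := Fintype.card_le_one_iff_subsingleton.1 (by omega)
    refine ⟨fun _ => ∅, by simp, fun e => ?_, by simp⟩
    induction e with
    | _ x y => rw [Subsingleton.elim y x, hw.diag, card_empty]
  · obtain ⟨s, t, T, hT, -, hTe⟩ := SimpleGraph.IsSeriesParallel.exists_tree (Fintype.card V - 2)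
      univ H (by rw [card_univ]; omega) (by simp) hH
    -- The added vertex `none` serves as the isolated vertex `o`.
    obtain ⟨φ, hφ⟩ := exists_coloring_of_tree none _ (T.map some) (some s)
      (some t) (addVertex w) rfl (by
        rw [SPTree.verts_map, List.nodup_cons]
        exact ⟨by simp, hT.map (Option.some_injective V)⟩) (fun e he => by
        induction e with
        | _ x y =>
          cases x with
          | none => exact absurd rfl he
          | some x =>
            cases y with
            | none => exact absurd rfl he
            | some y => exact SPTree.map_mem_edges some (hTe x y (hsup x y he))) hw.addVertex
    refine ⟨fun e => φ (e.map some), fun e => hφ.sub _, fun e => ?_, fun e e' v hv hv' hne => ?_⟩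
    · rw [hφ.card]
      induction e with
      | _ x y => rfl
    · exact hφ.disj _ _ (some v) (Sym2.mem_map.2 ⟨v, hv, rfl⟩) (Sym2.mem_map.2 ⟨v, hv', rfl⟩)
        fun h => hne (Sym2.map.injective (Option.some_injective V) h)

/-- Distribute the colours of `Φ κ` to the elements of `A` with the key `κ`. -/
theorem exists_injOn_fibers {E K : Type*} [DecidableEq K] (A : Finset E) (key : E → K)
    (Φ : K → Finset ℕ) (h : ∀ κ, (A.filter fun e => key e = κ).card ≤ (Φ κ).card) :
    ∃ c : E → ℕ, (∀ e ∈ A, c e ∈ Φ (key e)) ∧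
      ∀ e ∈ A, ∀ e' ∈ A, key e = key e' → c e = c e' → e = e' := by
  classical
  have h' : ∀ κ, ∃ f : E → ℕ, ∀ e ∈ A.filter fun e => key e = κ, f e ∈ Φ κ ∧
      ∀ e' ∈ A.filter fun e => key e = κ, f e = f e' → e = e' := by
    intro κ
    obtain ⟨f⟩ := Function.Embedding.nonempty_of_card_le
      (α := (A.filter fun e => key e = κ)) (β := Φ κ) (by simpa using h κ)
    refine ⟨fun e => if he : e ∈ A.filter fun e => key e = κ then f ⟨e, he⟩ else 0, ?_⟩
    intro e he
    simp only [he, dif_pos]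
    refine ⟨(f ⟨e, he⟩).2, fun e' he' hee' => ?_⟩
    simp only [he', dif_pos] at hee'
    simpa using f.injective (Subtype.ext hee')
  choose f hf using h'
  refine ⟨fun e => f (key e) e, fun e he => (hf _ e (by simp [he])).1, fun e he e' he' hk hc => ?_⟩
  simp only [← hk] at hc
  exact (hf (key e) e (by simp [he])).2 e' (by simp [he', hk]) hc

end WeightedGraph

/-! ### Colouring the scheduled blocks graph with `S` colours. -/

namespace OJSInstance

open Finset WeightedGraph

variable (P : OJSInstance)

/-- The ends of a wireless transmission of the packet `i` in the scheduled blocks graph: the two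
base stations in the case of a joint transmission, or the only base station. -/
def stations (i : P.Packet) : Sym2 P.BS ⊕ P.BS :=
  if P.joint i = true then
    .inl s(P.serving (P.user i), (P.secondary (P.user i)).getD (P.serving (P.user i)))
  else .inr (P.serving (P.user i))

theorem stations_cases (i : P.Packet) :
    (∃ b, P.joint i = true ∧ P.secondary (P.user i) = some b ∧ P.GJ.Adj (P.serving (P.user i)) b ∧
      P.stations i = .inl s(P.serving (P.user i), b)) ∨
    (P.joint i = false ∧ P.stations i = .inr (P.serving (P.user i))) := by
  by_cases h : P.joint i = true
  · obtain ⟨b, hb⟩ := Option.isSome_iff_exists.1 (P.joint_secondary i h)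
    exact .inl ⟨b, h, hb, P.secondary_adj _ _ hb, by simp [stations, h, hb]⟩
  · exact .inr ⟨by simpa using h, by simp [stations, h]⟩

open Classical in
/-- The number of blocks needed by the chosen transmissions with the given ends. -/
noncomputable def load (z : P.Packet → Option P.MCS → ℕ) (κ : Sym2 P.BS ⊕ P.BS) : ℕ :=
  ∑ i, ∑ m, if P.stations i = κ then z i (some m) * P.blocks i m else 0

variable {P}

theorem card_active_edges [DecidableEq (Sym2 P.BS ⊕ P.BS)] {z : P.Packet → Option P.MCS → ℕ}
    (hz : ∀ i r, z i r = 0 ∨ z i r = 1) (κ : Sym2 P.BS ⊕ P.BS) :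
    (((univ : Finset P.BlockEdge).filter fun e => z e.1 (some e.2.1) = 1).filter
      fun e => P.stations e.1 = κ).card = P.load z κ := by
  rw [filter_filter, card_filter, Fintype.sum_sigma, load]
  refine sum_congr rfl fun i _ => ?_
  rw [Fintype.sum_sigma]
  refine sum_congr rfl fun m _ => ?_
  rcases hz i (some m) with h | h <;> by_cases h' : P.stations i = κ <;> simp [h, h']

/-- The left side is the degree of `b`, dummy edges included: each transmission using `b` is counted
in one load only. -/
theorem sum_load_le [Fintype P.BS] {z : P.Packet → Option P.MCS → ℕ} {b : P.BS}
    (hcap : ∑ i, ∑ r, z i r * P.weight i r (.inl b) ≤ P.S) :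
    ∑ u, P.load z (.inl s(b, u)) + P.load z (.inr b) ≤ P.S := by
  classical
  refine le_trans ?_ hcap
  simp only [load]
  rw [sum_comm, ← sum_add_distrib]
  refine sum_le_sum fun i _ => ?_
  rw [sum_comm, ← sum_add_distrib, Fintype.sum_option]
  refine le_trans (sum_le_sum fun m _ => ?_) (Nat.le_add_left _ _)
  rcases P.stations_cases i with ⟨c, h1, h2, h3, h4⟩ | ⟨h1, h2⟩
  · have := sum_bundle h3.ne (z i (some m) * P.blocks i m) b
    simp only [eq_comm (a := s(b, _))] at this
    simp only [h4, Sum.inl.injEq, reduceCtorEq, if_false, add_zero, this, weight, Uses, h1, h2,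
      true_and, Option.some.injEq, eq_comm (a := c)]
    split_ifs <;> simp
  · simp only [h2, Sum.inr.injEq, reduceCtorEq, if_false, sum_const_zero, zero_add, weight, Uses,
      h1, eq_comm (a := b)]
    split_ifs <;> simp_all

theorem isBounded_load [Fintype P.BS] {z : P.Packet → Option P.MCS → ℕ}
    (hcap : ∀ b, ∑ i, ∑ r, z i r * P.weight i r (.inl b) ≤ P.S)
    (hodd : ∀ B' : P.OddSet, ∑ i, ∑ r, z i r * P.oddWeight i B' r ≤ P.S * (B'.1.card - 1) / 2) :
    IsBounded P.S fun e => P.load z (.inl e) := by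
  classical
  have hdiag : ∀ v, P.load z (.inl s(v, v)) = 0 := by
    intro v
    refine sum_eq_zero fun i _ => sum_eq_zero fun m _ => if_neg fun h => ?_
    rcases P.stations_cases i with ⟨c, h1, h2, h3, h4⟩ | ⟨h1, h2⟩
    · rw [h4, Sum.inl.injEq] at h
      rcases Sym2.eq_iff.1 h with ⟨rfl, rfl⟩ | ⟨rfl, rfl⟩ <;> exact h3.ne rfl
    · rw [h2] at h
      cases h
  refine ⟨hdiag, fun v => (Nat.le_add_right _ _).trans (sum_load_le (hcap v)), fun X hX => ?_⟩
  by_cases h3 : 3 ≤ X.card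
  · have h := hodd ⟨X, hX, h3⟩
    have hin : degSumOn (fun e => P.load z (.inl e)) X ≤
        2 * ∑ i, ∑ r, z i r * P.oddWeight i ⟨X, hX, h3⟩ r := by
      have : degSumOn (fun e => P.load z (.inl e)) X = ∑ i, ∑ m,
          degSumOn (fun e => if P.stations i = .inl e then z i (some m) * P.blocks i m else 0) X := by
        simp only [degSumOn, load]
        simp only [sum_comm (s := X) (t := (univ : Finset P.Packet)),
          sum_comm (s := X) (t := (univ : Finset P.MCS))]
      rw [this, mul_sum]
      refine sum_le_sum fun i _ => ?_
      rw [Fintype.sum_option, mul_add, mul_sum]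
      refine le_trans (sum_le_sum fun m _ => ?_) (Nat.le_add_left _ _)
      rcases P.stations_cases i with ⟨c, h1, h2, h3, h4⟩ | ⟨h1, h2⟩
      · have := degSumOn_bundle h3.ne (z i (some m) * P.blocks i m) X
        simp only [eq_comm (b := s(P.serving (P.user i), c))] at this
        simp only [h4, Sum.inl.injEq, this, oddWeight, Uses, h1, h2, true_and, Option.some.injEq,
          forall_eq_or_imp, forall_eq']
        split_ifs <;> simp
      · simp [h2, degSumOn]
    -- Since `degSumOn` counts edges twice, the rounding in the capacity does no harm.
    have h' : 2 * (P.S * (X.card - 1) / 2) ≤ P.S * (X.card - 1) := Nat.mul_div_le _ _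
    dsimp only at h
    have hX1 : P.S * (X.card - 1) + P.S = P.S * X.card := by
      rw [← Nat.mul_succ, Nat.succ_eq_add_one, Nat.sub_add_cancel (by omega)]
    omega
  · have h1 : X.card = 1 := by
      obtain ⟨j, hj⟩ := hX
      omega
    obtain ⟨v, rfl⟩ := card_eq_one.1 h1
    simp [degSumOn, hdiag]

theorem blocksGraph_inc {z : P.Packet → Option P.MCS → ℕ} {e : P.BlockEdge} {v : P.BS ⊕ P.BS} :
    (P.blocksGraph z).Inc e v ↔ z e.1 (some e.2.1) = 1 ∧
      ((∃ ε, P.stations e.1 = .inl ε ∧ ∃ b ∈ ε, v = .inl b) ∨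
        (∃ b, P.stations e.1 = .inr b ∧ (v = .inl b ∨ v = .inr b))) := by
  have : (P.blocksGraph z).Inc e v ↔
      z e.1 (some e.2.1) = 1 ∧ ∃ u, P.blockEnds e.1 v u := by
    simp [Graph.Inc, blocksGraph]
  rw [this]
  refine and_congr_right fun _ => ?_
  rcases P.stations_cases e.1 with ⟨c, h1, h2, h3, h4⟩ | ⟨h1, h2⟩
  · simp only [blockEnds, h1, h2, h4, if_true, Option.some.injEq, exists_eq_left', Sum.inl.injEq,
      reduceCtorEq, false_and, exists_false, or_false, Sym2.mem_iff, exists_eq_or_imp,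
      exists_eq_left]
    rw [← Sym2.mem_iff]
    exact ⟨fun ⟨u, hu⟩ => hu ▸ Sym2.mem_mk_left v u, fun h => ⟨Sym2.Mem.other h,
      Sym2.other_spec h⟩⟩
  · simp only [blockEnds, h1, h2, Bool.false_eq_true, if_false, Sum.inr.injEq, reduceCtorEq,
      false_and, exists_false, false_or, exists_eq_left']
    rw [← Sym2.mem_iff]
    exact ⟨fun ⟨u, hu⟩ => hu ▸ Sym2.mem_mk_left v u, fun h => ⟨Sym2.Mem.other h,
      Sym2.other_spec h⟩⟩

theorem mem_edgeSet_blocksGraph {z : P.Packet → Option P.MCS → ℕ} {e : P.BlockEdge}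
    (he : e ∈ (P.blocksGraph z).edgeSet) : z e.1 (some e.2.1) = 1 := by
  obtain ⟨u, v, h⟩ := he
  exact h.1

/-- The scheduled blocks graph has an edge colouring with `S` colours. -/
theorem exists_isEdgeColoring (hP : P.GJ.IsSeriesParallel) {z : P.Packet → Option P.MCS → ℕ}
    (hz : ∀ i r, z i r = 0 ∨ z i r = 1)
    (hcap : ∀ b, ∑ i, ∑ r, z i r * P.weight i r (.inl b) ≤ P.S)
    (hodd : ∀ B' : P.OddSet, ∑ i, ∑ r, z i r * P.oddWeight i B' r ≤ P.S * (B'.1.card - 1) / 2) :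
    ∃ c, (P.blocksGraph z).IsEdgeColoring P.S c := by
  classical
  have : Fintype P.BS := Fintype.ofFinite _
  obtain ⟨φ, hφ⟩ := WeightedGraph.exists_coloring hP (fun x y hxy => by
    by_contra hadj
    refine hxy (sum_eq_zero fun i _ => sum_eq_zero fun m _ => if_neg fun h => hadj ?_)
    rcases P.stations_cases i with ⟨c, h1, h2, h3, h4⟩ | ⟨h1, h2⟩
    · rw [h4, Sum.inl.injEq] at h
      rcases Sym2.eq_iff.1 h with ⟨rfl, rfl⟩ | ⟨rfl, rfl⟩
      exacts [h3, h3.symm]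
    · rw [h2] at h
      cases h) (isBounded_load hcap hodd)
  -- The edges to the dummy vertex of `b` get colours that the joint transmissions leave unused at
  -- `b`.
  have hL := fun b => exists_free_superset hφ (v := b) (D := ∅) (by simp) (by simp)
    (n := P.load z (.inr b)) (by simp) (sum_load_le (hcap b))
  choose L _ hLk hLc hLd using hL
  obtain ⟨c, hc, hinj⟩ := exists_injOn_fibers
    ((univ : Finset P.BlockEdge).filter fun e => z e.1 (some e.2.1) = 1)
    (fun e => P.stations e.1) (Sum.elim φ L) (by
      rintro (ε | b)
      · rw [card_active_edges hz]; exact (hφ.card ε).ge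
      · rw [card_active_edges hz]; exact (hLc b).ge)
  have hmem : ∀ e ∈ (P.blocksGraph z).edgeSet,
      e ∈ (univ : Finset P.BlockEdge).filter fun e => z e.1 (some e.2.1) = 1 := fun e he => by
    simpa using mem_edgeSet_blocksGraph he
  refine ⟨c, fun e he => ?_, ?_⟩
  · have h := hc e (hmem e he)
    rw [← mem_range]
    generalize P.stations e.1 = κ at h
    cases κ
    exacts [hφ.sub _ h, hLk _ h]
  · rintro e he e' he' hne ⟨v, hv, hv'⟩ hcc
    have h := hc e (hmem e he)
    have h' := hc e' (hmem e' he')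
    by_cases hk : P.stations e.1 = P.stations e'.1
    · exact hne (hinj e (hmem e he) e' (hmem e' he') hk hcc)
    rw [hcc] at h
    rw [blocksGraph_inc] at hv hv'
    have hLd' : ∀ b ε, b ∈ ε → Disjoint (L b) (φ ε) := fun b ε hb => by
      obtain ⟨y, rfl⟩ := Sym2.mem_iff_exists.1 hb
      exact hLd b y
    rcases hv.2 with ⟨ε, h1, b, hb, rfl⟩ | ⟨b, h1, h2⟩ <;>
      rcases hv'.2 with ⟨ε', h1', b', hb', h2'⟩ | ⟨b', h1', h2'⟩
    · obtain rfl := Sum.inl_injective h2'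
      rw [h1] at h
      rw [h1'] at h'
      exact disjoint_left.1 (hφ.disj ε ε' b hb hb' fun h => hk (by rw [h1, h1', h])) h h'
    · have : b = b' := by simpa using h2'
      subst this
      rw [h1] at h
      rw [h1'] at h'
      exact disjoint_left.1 (hLd' b ε hb) h' h
    · subst h2'
      have : b' = b := by simpa using h2
      subst this
      rw [h1] at h
      rw [h1'] at h'
      exact disjoint_left.1 (hLd' b' ε' hb') h h'
    · refine hk ?_
      rw [h1, h1']
      rcases h2 with rfl | rfl <;> simpa using h2'

end OJSInstance

/-! ### Dummy vertices do not destroy series-parallelity. -/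

namespace OJSInstance

open Finset

variable {P : OJSInstance}

theorem blocksGraph_isLink {z : P.Packet → Option P.MCS → ℕ} {e : P.BlockEdge} {u v : P.BS ⊕ P.BS}
    (h : (P.blocksGraph z).IsLink e u v) :
    (∃ a b, u = .inl a ∧ v = .inl b ∧ P.GJ.Adj a b) ∨
      ∃ b, (u = .inl b ∧ v = .inr b) ∨ (u = .inr b ∧ v = .inl b) := by
  have h2 : P.blockEnds e.1 u v := h.2
  rcases P.stations_cases e.1 with ⟨c, h3, h4, h5, -⟩ | ⟨h3, -⟩
  · simp only [blockEnds, h3, if_true, h4, Option.some.injEq, exists_eq_left', Sym2.eq_iff] at h2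
    rcases h2 with ⟨rfl, rfl⟩ | ⟨rfl, rfl⟩
    exacts [.inl ⟨_, _, rfl, rfl, h5⟩, .inl ⟨_, _, rfl, rfl, h5.symm⟩]
  · simp only [blockEnds, h3, Bool.false_eq_true, if_false, Sym2.eq_iff] at h2
    exact .inr ⟨_, h2⟩

/-- Contract each dummy vertex to its base station; the steps along pendant edges disappear. -/
theorem exists_walk_of_blocksGraph {H : SimpleGraph (P.BS ⊕ P.BS)}
    (hH : ∀ u v, H.Adj u v → (∃ a b, u = .inl a ∧ v = .inl b ∧ P.GJ.Adj a b) ∨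
      ∃ b, (u = .inl b ∧ v = .inr b) ∨ (u = .inr b ∧ v = .inl b)) {u v : P.BS ⊕ P.BS}
    (p : H.Walk u v) : ∃ q : P.GJ.Walk (u.elim id id) (v.elim id id),
      ∀ b ∈ q.support, .inl b ∈ p.support ∨ .inr b ∈ p.support := by
  induction p with
  | @nil u =>
    refine ⟨.nil, fun b hb => ?_⟩
    obtain rfl : b = u.elim id id := by simpa using hb
    cases u <;> simp
  | @cons u v w h p ih =>
    obtain ⟨q, hq⟩ := ih
    rcases hH u v h with ⟨a, b, rfl, rfl, hab⟩ | ⟨b, ⟨rfl, rfl⟩ | ⟨rfl, rfl⟩⟩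
    · refine ⟨.cons hab q, fun x hx => ?_⟩
      rcases List.mem_cons.1 hx with rfl | hx
      · simp
      · exact (hq x hx).imp (List.mem_cons_of_mem _) (List.mem_cons_of_mem _)
    all_goals
      exact ⟨q, fun x hx => (hq x hx).imp (List.mem_cons_of_mem _) (List.mem_cons_of_mem _)⟩

theorem inl_mem_support_of_inr_mem {H : SimpleGraph (P.BS ⊕ P.BS)}
    (hH : ∀ u v, H.Adj u v → (∃ a b, u = .inl a ∧ v = .inl b ∧ P.GJ.Adj a b) ∨
      ∃ b, (u = .inl b ∧ v = .inr b) ∨ (u = .inr b ∧ v = .inl b)) {u v : P.BS ⊕ P.BS}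
    (p : H.Walk u v) {b : P.BS} (hb : .inr b ∈ p.support) (huv : u ≠ v) : .inl b ∈ p.support := by
  have key : ∀ {u v : P.BS ⊕ P.BS} (p : H.Walk u v), u ≠ .inr b → .inr b ∈ p.support →
      .inl b ∈ p.support := by
    intro u v p
    induction p with
    | nil => intro h h'; simp at h'; exact absurd h'.symm h
    | @cons u v w h p ih =>
      intro hu hmem
      rw [SimpleGraph.Walk.support_cons, List.mem_cons] at hmem ⊢
      rcases hmem with h' | h'
      · exact absurd h'.symm hu
      · by_cases hv : v = .inr b
        · subst hv
          rcases hH _ _ h with ⟨a, c, -, h2, -⟩ | ⟨c, ⟨h1, h2⟩ | ⟨h1, h2⟩⟩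
          · cases h2
          · cases h2
            exact .inl h1.symm
          · cases h2
        · exact .inr (ih hv h')
  by_cases hu : u = .inr b
  · have := key p.reverse (fun h => huv (hu.trans h.symm)) (by simpa using hb)
    simpa using this
  · exact key p hu hb

/-- If a dummy vertex were a branch vertex, two paths leaving it would share its only neighbour,
which would have to be the other end of both. So all branch vertices are base stations, and
contracting dummy vertices turns the paths into walks in `G_J` whose vertices already lay on them.
-/
theorem isSeriesParallel_of_adj {H : SimpleGraph (P.BS ⊕ P.BS)}
    (hH : ∀ u v, H.Adj u v → (∃ a b, u = .inl a ∧ v = .inl b ∧ P.GJ.Adj a b) ∨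
      ∃ b, (u = .inl b ∧ v = .inr b) ∨ (u = .inr b ∧ v = .inl b))
    (hP : P.GJ.IsSeriesParallel) : H.IsSeriesParallel := by
  rintro ⟨f, p, hf, -, hp⟩
  have hinl : ∀ i j, i < j → ∀ b, (.inl b ∈ (p i j).support ∨ .inr b ∈ (p i j).support) →
      .inl b ∈ (p i j).support := by
    rintro i j hij b (h | h)
    · exact h
    · exact inl_mem_support_of_inr_mem hH _ h fun h => hij.ne (hf h)
  -- no branch vertex is a dummy vertex
  have hbr : ∀ i b, f i ≠ .inr b := by
    intro i b hi
    have key : ∀ j, j ≠ i → ∃ k l, k < l ∧ ((k = i ∧ l = j) ∨ (k = j ∧ l = i)) ∧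
        Sum.inl b ∈ (p k l).support := by
      intro j hj
      rcases lt_or_gt_of_ne hj with h | h
      · exact ⟨j, i, h, .inr ⟨rfl, rfl⟩, hinl _ _ h b (.inr (hi ▸ (p j i).end_mem_support))⟩
      · exact ⟨i, j, h, .inl ⟨rfl, rfl⟩, hinl _ _ h b (.inr (hi ▸ (p i j).start_mem_support))⟩
    obtain ⟨j, j', hj, hj', hjj⟩ : ∃ j j' : Fin 4, j ≠ i ∧ j' ≠ i ∧ j ≠ j' :=
      (by decide : ∀ i : Fin 4, ∃ j j' : Fin 4, j ≠ i ∧ j' ≠ i ∧ j ≠ j') i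
    obtain ⟨k, l, hkl, h1, h2⟩ := key j hj
    obtain ⟨k', l', hkl', h1', h2'⟩ := key j' hj'
    have h := hp k l k' l' hkl hkl' (by
      rintro h
      obtain ⟨rfl, rfl⟩ := Prod.mk.inj h
      omega) _ h2 h2'
    have g1 : .inl b = f j := by
      rcases h1 with ⟨rfl, rfl⟩ | ⟨rfl, rfl⟩ <;> simpa [hi] using h.1
    have g2 : .inl b = f j' := by
      rcases h1' with ⟨rfl, rfl⟩ | ⟨rfl, rfl⟩ <;> simpa [hi] using h.2
    exact hjj (hf (g1.symm.trans g2))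
  have hfi : ∀ i, ∃ b, f i = .inl b := fun i => by
    cases h : f i with
    | inl b => exact ⟨b, rfl⟩
    | inr b => exact absurd h (hbr i b)
  choose g hg using hfi
  have hge : ∀ i, (f i).elim id id = g i := fun i => by rw [hg]; rfl
  refine hP (SimpleGraph.hasK4Subdivision_of_sets g (fun i j h => hf (by rw [hg, hg, h]))
    (fun i j => {b | .inl b ∈ (p i j).support}) ?_ ?_)
  · intro i j hij
    rw [← hge, ← hge]
    obtain ⟨q, hq⟩ := exists_walk_of_blocksGraph hH (p i j)
    exact ⟨q, fun b hb => hinl i j hij b (hq b hb)⟩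
  · intro i j k l hij hkl hne b hb hb'
    have := hp i j k l hij hkl hne _ hb hb'
    simpa [hg] using this

end OJSInstance

theorem SimpleGraph.HasK4Subdivision.map {V W : Type*} {H : SimpleGraph V} {H' : SimpleGraph W}
    (h : H.HasK4Subdivision) (φ : H →g H') (hφ : Function.Injective φ) : H'.HasK4Subdivision := by
  obtain ⟨f, p, hf, -, hp⟩ := h
  refine hasK4Subdivision_of_sets (fun i => φ (f i)) (hφ.comp hf)
    (fun i j => {v | ∃ u ∈ (p i j).support, φ u = v}) (fun i j _ => ⟨(p i j).map φ, fun v hv => ?_⟩)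
    ?_
  · simpa [Walk.support_map] using hv
  · rintro i j k l hij hkl hne v ⟨u, hu, rfl⟩ ⟨u', hu', huu⟩
    obtain rfl := hφ huu
    have := hp i j k l hij hkl hne _ hu hu'
    exact ⟨this.1.imp (congrArg φ) (congrArg φ), this.2.imp (congrArg φ) (congrArg φ)⟩

/-! ### Correctness of the two steps of the algorithm. -/

namespace OJSInstance

open Finset

variable {P : OJSInstance}

theorem blocksGraph_loopless (z : P.Packet → Option P.MCS → ℕ) : (P.blocksGraph z).Loopless := by
  refine ⟨fun e x h => ?_⟩
  rcases blocksGraph_isLink (h : (P.blocksGraph z).IsLink e x x) with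
    ⟨a, b, rfl, h2, hab⟩ | ⟨b, ⟨rfl, h2⟩ | ⟨rfl, h2⟩⟩
  · exact hab.ne (Sum.inl_injective h2)
  · cases h2
  · cases h2

theorem blocksGraph_isSeriesParallel (hP : P.GJ.IsSeriesParallel)
    (z : P.Packet → Option P.MCS → ℕ) : (P.blocksGraph z).IsSeriesParallel := by
  let H : SimpleGraph (P.BS ⊕ P.BS) :=
    { Adj := fun u v => u ≠ v ∧ (P.blocksGraph z).Adj u v
      symm := ⟨fun u v h => ⟨h.1.symm, h.2.symm⟩⟩
      loopless := ⟨fun u h => h.1 rfl⟩ }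
  have hH : H.IsSeriesParallel := isSeriesParallel_of_adj (fun u v h => by
    obtain ⟨-, e, he⟩ := h
    exact blocksGraph_isLink he) hP
  intro h
  refine hH (h.map ⟨fun v => v.1, fun {u v} huv => ?_⟩ Subtype.val_injective)
  exact ⟨fun h => huv.1 (Subtype.ext h), huv.2⟩

theorem blocksGraph_inc_of_uses {z : P.Packet → Option P.MCS → ℕ} {i : P.Packet} {m : P.MCS}
    (hz : z i (some m) = 1) (k : Fin (P.blocks i m)) {b : P.BS} (hb : P.Uses i b) :
    (P.blocksGraph z).Inc ⟨i, m, k⟩ (.inl b) := by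
  refine blocksGraph_inc.2 ⟨hz, ?_⟩
  rcases P.stations_cases i with ⟨c, h1, h2, h3, h4⟩ | ⟨h1, h2⟩
  · refine .inl ⟨_, h4, b, ?_, rfl⟩
    rcases hb with rfl | ⟨-, hb⟩
    · simp
    · rw [h2, Option.some.injEq] at hb
      simp [hb]
  · rcases hb with rfl | ⟨hb, -⟩
    · exact .inr ⟨_, h2, .inl rfl⟩
    · simp [h1] at hb

/-- An edge colouring of the scheduled blocks graph with at most `S` colours yields a feasible
assignment of the scheduled blocks. -/
theorem feasibleBlocks_coloringStep {C : EdgeColoringAlgorithm} {z : P.Packet → Option P.MCS → ℕ}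
    (hz : ∀ i r, z i r = 0 ∨ z i r = 1) {k : ℕ} (hk : k ≤ P.S)
    (hC : (P.blocksGraph z).IsEdgeColoring k (C _ _ (P.blocksGraph z))) :
    P.FeasibleBlocks z (coloringStep C P z) := by
  classical
  set c := C _ _ (P.blocksGraph z) with hc
  have hx : ∀ i m s, coloringStep C P z i m s =
      if z i (some m) = 1 ∧ ∃ k : Fin (P.blocks i m), c ⟨i, m, k⟩ = s then 1 else 0 := by
    intro i m s
    simp only [coloringStep, hc]
  have hinc : ∀ i m (k : Fin (P.blocks i m)) b, z i (some m) = 1 → P.Uses i b →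
      (P.blocksGraph z).Inc ⟨i, m, k⟩ (.inl b) := fun i m k b h hb => blocksGraph_inc_of_uses h k hb
  have hne : ∀ e e' : P.BlockEdge, ∀ v, (P.blocksGraph z).Inc e v → (P.blocksGraph z).Inc e' v →
      c e = c e' → e = e' := fun e e' v he he' hcc => by
    by_contra h
    exact hC.2 e he.edge_mem e' he'.edge_mem h ⟨v, he, he'⟩ hcc
  refine ⟨fun i m s => ?_, fun i m => ?_, fun b s => ?_⟩
  · rw [hx]; split_ifs <;> simp
  · simp only [hx]
    rcases hz i (some m) with h | h
    · simp [h]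
    · simp only [h, true_and, one_mul]
      rw [← card_filter]
      have hlt : ∀ k : Fin (P.blocks i m), c ⟨i, m, k⟩ < P.S := fun k =>
        (hC.1 _ (hinc i m k _ h (.inl rfl)).edge_mem).trans_le hk
      -- The parallel edges of a transmission meet at its serving station, so their colours are
      -- distinct and count its blocks.
      have himg : (univ.filter fun s : Fin P.S => ∃ k : Fin (P.blocks i m), c ⟨i, m, k⟩ = s) =
          univ.image fun k : Fin (P.blocks i m) => (⟨c ⟨i, m, k⟩, hlt k⟩ : Fin P.S) := by
        ext s
        simp [Fin.ext_iff]
      rw [himg, card_image_of_injective, card_univ, Fintype.card_fin]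
      intro k k' hkk
      have := hne ⟨i, m, k⟩ ⟨i, m, k'⟩ _ (hinc i m k _ h (.inl rfl)) (hinc i m k' _ h (.inl rfl))
        (by simpa using hkk)
      simpa using this
  · simp only [hx]
    rw [← sum_product', ← card_filter, card_le_one]
    rintro ⟨m, i⟩ h ⟨m', i'⟩ h'
    simp only [mem_filter, mem_product, mem_univ, true_and] at h h'
    obtain ⟨hb, hzi, k, hk⟩ := h
    obtain ⟨hb', hzi', k', hk'⟩ := h'
    have := hne ⟨i, m, k⟩ ⟨i', m', k'⟩ _ (hinc i m k b hzi hb) (hinc i' m' k' b hzi' hb')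
      (hk.trans hk'.symm)
    obtain ⟨rfl, h2⟩ := Sigma.mk.inj this
    obtain ⟨rfl, -⟩ := Sigma.mk.inj (eq_of_heq h2)
    rfl

/-- Translates sums over knapsack items into sums over all pairs, since the unavailable pairs
contribute nothing. -/
theorem sum_items {M : Type*} [AddCommMonoid M] (F : P.Packet → Option P.MCS → M)
    (h : ∀ i r, ¬(r = none → P.Forwardable i) → F i r = 0) :
    ∑ j : P.oddKnapsack.Item, F j.1.1 j.1.2 = ∑ i, ∑ r, F i r := by
  rw [← Fintype.sum_prod_type' (f := F)]
  refine Fintype.sum_of_injective (fun j : P.oddKnapsack.Item => j.1) Subtype.val_injective _ _ ?_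
    fun _ => rfl
  rintro ⟨i, r⟩ hj
  exact h i r fun hj' => hj ⟨⟨(i, r), hj'⟩, rfl⟩

theorem feasible_oddKnapsack_iff {z : P.Packet → Option P.MCS → ℕ}
    (hz : ∀ i r, ¬(r = none → P.Forwardable i) → z i r = 0) :
    P.oddKnapsack.Feasible (fun j => z j.1.1 j.1.2) ↔ P.FeasibleConfig z ∧
      ∀ B' : P.OddSet, ∑ i, ∑ r, z i r * P.oddWeight i B' r ≤ P.S * (B'.1.card - 1) / 2 := by
  classical
  have hcls : ∀ i : P.Packet, ∑ j : P.oddKnapsack.Item with j.1.1 = i, z j.1.1 j.1.2 =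
      ∑ r, z i r := by
    intro i
    rw [sum_filter]
    refine (sum_items (fun i' r => if i' = i then z i' r else 0) fun i' r h => ?_).trans ?_
    · simp [hz i' r h]
    · rw [sum_eq_single i (fun i' _ h => by simp [h]) (by simp)]
      simp
  have hw : ∀ g : P.Packet → Option P.MCS → ℕ,
      ∑ j : P.oddKnapsack.Item, z j.1.1 j.1.2 * g j.1.1 j.1.2 = ∑ i, ∑ r, z i r * g i r :=
    fun g => sum_items (fun i r => z i r * g i r) fun i r h => by simp [hz i r h]
  constructor
  · rintro ⟨h1, h2, h3⟩
    refine ⟨⟨fun i r => ?_, fun i hi => hz i none fun h => hi (h rfl), fun i => ?_, fun d => ?_⟩,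
      fun B' => ?_⟩
    · by_cases h : r = none → P.Forwardable i
      · exact h1 ⟨(i, r), h⟩
      · exact .inl (hz i r h)
    · refine (hcls i).ge.trans ?_
      refine le_of_eq_of_le ?_ (h2 i)
      congr!
    · rw [← hw fun i r => P.weight i r d]
      exact h3 (.inl d)
    · rw [← hw fun i r => P.oddWeight i B' r]
      exact h3 (.inr B')
  · rintro ⟨⟨h1, h2, h3, h4⟩, h5⟩
    refine ⟨fun j => h1 _ _, fun i => ?_, ?_⟩
    · refine le_trans ?_ ((hcls i).trans_le (h3 i))
      refine le_of_eq ?_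
      congr!
    · rintro (d | B')
      · exact (hw fun i r => P.weight i r d).trans_le (h4 d)
      · exact (hw fun i r => P.oddWeight i B' r).trans_le (h5 B')

theorem value_oddKnapsack {z : P.Packet → Option P.MCS → ℕ}
    (hz : ∀ i r, ¬(r = none → P.Forwardable i) → z i r = 0) :
    P.oddKnapsack.value (fun j => z j.1.1 j.1.2) = P.totalUtility z :=
  sum_items (fun i r => (z i r : ℝ) * P.utility i r) fun i r h => by simp [hz i r h]

/-- In a feasible solution, each block is used by at most `(|B'| - 1) / 2` of the joint
transmissions inside an odd set `B'`. -/
theorem odd_bound_of_feasibleBlocks {z : P.Packet → Option P.MCS → ℕ}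
    {x : P.Packet → P.MCS → Fin P.S → ℕ} (h : P.FeasibleBlocks z x) (B' : P.OddSet) :
    ∑ i, ∑ r, z i r * P.oddWeight i B' r ≤ P.S * (B'.1.card - 1) / 2 := by
  classical
  let I : Finset P.Packet :=
    univ.filter fun i => P.joint i = true ∧ ∀ b, P.Uses i b → b ∈ B'.1
  have hsum : ∑ i, ∑ r, z i r * P.oddWeight i B' r = ∑ s, ∑ m, ∑ i ∈ I, x i m s := by
    have h1 : ∀ i, ∑ r, z i r * P.oddWeight i B' r =
        if P.joint i = true ∧ ∀ b, P.Uses i b → b ∈ B'.1 then ∑ m, ∑ s, x i m s else 0 := by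
      intro i
      rw [Fintype.sum_option]
      by_cases hi : P.joint i = true ∧ ∀ b, P.Uses i b → b ∈ B'.1
      · simp only [oddWeight, if_pos hi, mul_zero, zero_add, h.sufficient]
      · simp only [oddWeight, if_neg hi, mul_zero, sum_const_zero, add_zero]
    rw [sum_congr rfl fun i _ => h1 i, ← sum_filter, sum_comm, sum_comm (s := univ) (t := univ)]
    refine sum_congr rfl fun m _ => ?_
    rw [sum_comm]
  have hblock : ∀ s, 2 * ∑ m, ∑ i ∈ I, x i m s ≤ B'.1.card - 1 := by
    intro s
    -- Double counting: a joint transmission inside `B'` is seen from two distinct stations of `B'`.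
    have h1 : 2 * ∑ m, ∑ i ∈ I, x i m s ≤ ∑ b ∈ B'.1, ∑ m, ∑ i with P.Uses i b, x i m s := by
      rw [sum_comm (s := B'.1), mul_sum]
      refine sum_le_sum fun m _ => ?_
      simp only [sum_filter]
      rw [sum_comm, mul_sum]
      refine (sum_le_sum fun i hi => ?_).trans (sum_le_sum_of_subset (subset_univ I))
      obtain ⟨hj, hB⟩ := (mem_filter.1 hi).2
      rcases P.stations_cases i with ⟨c, -, h2, h3, -⟩ | ⟨h1, -⟩
      · have hc : P.Uses i c := .inr ⟨hj, h2⟩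
        have hs : P.Uses i (P.serving (P.user i)) := .inl rfl
        have hsub : ({P.serving (P.user i), c} : Finset P.BS) ⊆ B'.1 := by
          intro b hb
          rcases mem_insert.1 hb with rfl | hb
          · exact hB _ hs
          · exact mem_singleton.1 hb ▸ hB _ hc
        refine le_trans ?_ (sum_le_sum_of_subset hsub)
        rw [sum_pair h3.ne, if_pos hs, if_pos hc, two_mul]
      · simp [h1] at hj
    have h2 : ∑ b ∈ B'.1, ∑ m, ∑ i with P.Uses i b, x i m s ≤ B'.1.card := by
      refine (sum_le_card_nsmul _ _ 1 fun b _ => ?_).trans (by simp)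
      convert h.used_once b s
    -- An even number that is at most the odd number `|B'|` is at most `|B'| - 1`.
    obtain ⟨j, hj⟩ := B'.2.1
    omega
  rw [hsum, Nat.le_div_iff_mul_le two_pos, mul_comm, mul_sum]
  refine (sum_le_sum fun s _ => hblock s).trans ?_
  simp

end OJSInstance

theorem mainTheorem3 (α : ℝ) (hα0 : 0 < α) (hα1 : α ≤ 1)
    (A : MMKAlgorithm) (hA : A.IsApprox α)
    (C : EdgeColoringAlgorithm) (hC : C.IsOptimalOnSeriesParallel) :
    OJSAlgorithm.IsApproxOn (fun P => P.GJ.IsSeriesParallel) α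
      (decomposition (OJSInstance.knapsackStep A) (OJSInstance.coloringStep C)) := by
  intro P hP
  obtain ⟨hQ, hbest⟩ := hA P.oddKnapsack
  have hz : ∀ i r, ¬(r = none → P.Forwardable i) → OJSInstance.knapsackStep A P i r = 0 :=
    fun i r h => dif_neg h
  have hAz : A P.oddKnapsack = fun j => OJSInstance.knapsackStep A P j.1.1 j.1.2 :=
    by
    funext j
    rw [OJSInstance.knapsackStep, dif_pos j.2]
    rfl
  rw [hAz] at hQ hbest
  obtain ⟨hconf, hodd⟩ := (OJSInstance.feasible_oddKnapsack_iff hz).1 hQ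
  refine ⟨⟨hconf, ?_⟩, fun y hy => ?_⟩
  · have := OJSInstance.blocksGraph_loopless (OJSInstance.knapsackStep A P)
    -- Some colouring has `S` colours, so the chromatic index, and with it the number of colours
    -- used by `C`, is at most `S`.
    exact OJSInstance.feasibleBlocks_coloringStep hconf.binary
      (Nat.sInf_le (OJSInstance.exists_isEdgeColoring hP hconf.binary
        (fun b => hconf.capacities (.inl b)) hodd))
      (hC _ _ (P.blocksGraph (OJSInstance.knapsackStep A P)) this
        (OJSInstance.blocksGraph_isSeriesParallel hP _))
  -- The competing solution is compared inside the knapsack instance, whose odd set constraints it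
  -- satisfies.
  · have hy0 : ∀ i r, ¬(r = none → P.Forwardable i) → y.1 i r = 0 := by
      intro i r h
      rw [Classical.not_imp] at h
      rw [h.1]
      exact hy.1.forwardable i h.2
    have := hbest _ ((OJSInstance.feasible_oddKnapsack_iff hy0).2
      ⟨hy.1, OJSInstance.odd_bound_of_feasibleBlocks hy.2⟩)
    rwa [OJSInstance.value_oddKnapsack hy0, OJSInstance.value_oddKnapsack hz] at this
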